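/- Let $0<d<1$, $u=1/d$ and $\frac{d}{1+d}<p<\frac1{1+d}$. Consider the binomial model $S_0=1$, where, independently in each period, $S_{t+1}=uS_t$ with probability $p$ and $S_{t+1}=dS_t$ with probability $1-p$. The interest rate is $0$, and there are proportional transaction costs $\lambda\in(0,1)$: the ask price is $S$ and the bid price is $(1-\lambda)S$. A trading strategy for the horizon $T$ is a process $(\varphi^0_t,\varphi_t)_{-1\le t\le T}$ (bonds, stocks), adapted to the filtration of $S$, with $(\varphi^0_{-1},\varphi_{-1})=(x,0)$, $x>0$. It is admissible if for $0\le t\le T$ $$\varphi^0_t-\varphi^0_{t-1}+(\varphi_t-\varphi_{t-1})S_t\le 0,\qquad \varphi^0_t-\varphi^0_{t-1}+(\varphi_t-\varphi_{t-1})(1-\lambda)S_t\le 0,$$ $$V_t=\varphi^0_t+\varphi_t^+(1-\lambda)S_t-\varphi_t^-S_t\ge 0.$$ The optimal growth rate is $\limsup_{T\to\infty}\frac1T\sup \mathbb E[\log V_T]$, where the supremum is over the admissible strategies for the horizon $T$ (it is the expected log-utility of the log-optimal portfolio; $\log 0=-\infty$). Put $\bar c=\frac{1-p-pd}{p+pd-d}$,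 and let $I=(\bar c,\infty)$ if $p\le\frac12$, $I=\bigl(\bar c,\frac{1-p-pd}{2p-1}\bigr)$ if $p>\frac12$. For $p\ne\frac12$ put $b=\frac{\log d}{\log((1-p)/p)}$, $$r(c)=\frac{[c(p+pd-d)+d(2p-1)][1-p-pd-c(2p-1)]}{c(1-d)^2(1-p)^2},$$ $$F(c)=1-\Bigl(\tfrac{c(p+pd-d)+d(2p-1)}{(1-d)(1-p)}\Bigr)^2r(c)^{b-1},\qquad k(c)=\frac{\log r(c)}{\log((1-p)/p)},$$ $$G(c)=\frac{1-2p}{(1-p)\bigl(1-(\frac p{1-p})^{k(c)+1}\bigr)}\Bigl[(1-p)\log\tfrac{c+d}{c+1}+p\bigl(\tfrac p{1-p}\bigr)^{k(c)}\log\tfrac{(c+d)p}{(c+1)(1-p)d}\Bigr],$$ $$\eta=\frac{(2p-1)\log d}{(1-d)\log((1-p)/p)},$$ and for $p=\frac12$ put $$F(c)=1-c^2d^{k(c)},\quad k(c)=\frac{(c+d)(c-1)}{c(1-d)},\quad G(c)=\frac{c(1-d)}{c^2-d}\log\frac{c+d}{\sqrt d(c+1)},\quad \eta=\frac{\log d}{-2(1-d)}.$$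 For every $\lambda\in(0,1)$ the equation $F(c)=\lambda$ has a unique solution $c=c(\lambda)\in I$. Put $R(\lambda)=G(c(\lambda))$. Then: 1. whenever $k(c(\lambda))$ is a positive integer, the optimal growth rate of the model with transaction costs $\lambda$ equals $R(\lambda)$, for every initial wealth $x>0$; 2. the function $R$, which expresses the optimal growth rate through $\lambda$, has the expansion $$R(\lambda)=\log\frac{(1+d)p^p(1-p)^{1-p}}{d^p}+R_1\lambda+\mathcal O(\lambda^2),$$ $$R_1=\frac{(p+pd-d)(1-p-pd)-(1+d)^2(1-p)p\log\bigl(\frac{(1+d)^2(1-p)p}{d}\bigr)}{(1-d^2)[(1+d)\eta-1]},$$ and the error is at most $C\lambda^2$ for all $\lambda\in(0,1)$, with a constant $C$ that depends only on $p$ and $d$; 3. $R_1<0$. So $R$ depends on $\lambda$ linearly to first order, and not at order $\lambda^{2/3}$. -/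

import Mathlib

open Set Filter Topology

namespace BinomialMarket

noncomputable section

/-! ### The binomial model with proportional transaction costs -/

/-- The outcomes of the binomial model with `T` periods: `ω i = true` means that the stock price
goes up between the times `i` and `i + 1`, and `ω i = false` that it goes down. -/
abbrev Path (T : ℕ) : Type := Fin T → Bool

/-- The probability of a path: the steps are independent, each of them goes up with
probability `p` and down with probability `1 - p`. -/
def pathProb (p : ℝ) {T : ℕ} (ω : Path T) : ℝ :=
  ∏ i : Fin T, if ω i then p else 1 - p

/-- The expectation of a random variable on the path space. -/
def expect (p : ℝ) {T : ℕ} (X : Path T → ℝ) : ℝ :=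
  ∑ ω : Path T, pathProb p ω * X ω

/-- The stock price (which is also the ask price) at time `t ≤ T`; it starts in `S₀ = 1`, and in
every period it is multiplied by `u = 1 / d` or by `d`. -/
def stockPrice (d : ℝ) {T : ℕ} (t : ℕ) (ω : Path T) : ℝ :=
  ∏ i : Fin T, if (i : ℕ) < t then (if ω i then d⁻¹ else d) else 1

/-- A process `X₀, …, X_T` is adapted to the filtration generated by the stock price: `X t`
depends on the first `t` steps only. -/
def IsAdaptedProcess {T : ℕ} (X : ℕ → Path T → ℝ) : Prop :=
  ∀ t ≤ T, ∀ ω ω' : Path T, (∀ i : Fin T, (i : ℕ) < t → ω i = ω' i) → X t ω = X t ω'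

/-- The value of a process one time step earlier, where the value at time `-1` is the
constant `a`. -/
def previous (a : ℝ) {T : ℕ} (X : ℕ → Path T → ℝ) : ℕ → Path T → ℝ
  | 0, _ => a
  | t + 1, ω => X t ω

/-- The wealth at time `t` after liquidation of the stock position: a long position is sold at the
bid price `(1 - lam) S`, a short position is closed at the ask price `S`. -/
def wealth (d lam : ℝ) {T : ℕ} (bond stock : ℕ → Path T → ℝ) (t : ℕ) (ω : Path T) : ℝ :=
  bond t ω + max (stock t ω) 0 * ((1 - lam) * stockPrice d t ω)
    - max (-stock t ω) 0 * stockPrice d t ω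

/-- `(bond, stock)` is an admissible (adapted, self-financing, with non-negative wealth) trading
strategy up to the horizon `T`, with position `(x, 0)` before the first trade, for the bid-ask
process `((1 - lam) S, S)`. -/
structure IsAdmissible (d lam x : ℝ) {T : ℕ} (bond stock : ℕ → Path T → ℝ) : Prop where
  adapted_bond : IsAdaptedProcess bond
  adapted_stock : IsAdaptedProcess stock
  self_financing_ask : ∀ t ≤ T, ∀ ω : Path T,
    bond t ω - previous x bond t ω
      + (stock t ω - previous 0 stock t ω) * stockPrice d t ω ≤ 0
  self_financing_bid : ∀ t ≤ T, ∀ ω : Path T,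
    bond t ω - previous x bond t ω
      + (stock t ω - previous 0 stock t ω) * ((1 - lam) * stockPrice d t ω) ≤ 0
  wealth_nonneg : ∀ t ≤ T, ∀ ω : Path T, 0 ≤ wealth d lam bond stock t ω

open Classical in
/-- The expected logarithmic utility `E[log V_T]` of the terminal wealth of a strategy, with the
convention `log 0 = -∞` (for `0 < p < 1` every path has positive probability). -/
def logUtility (p d lam : ℝ) {T : ℕ} (bond stock : ℕ → Path T → ℝ) : EReal :=
  if ∀ ω : Path T, 0 < wealth d lam bond stock T ω then
    ((expect p fun ω : Path T => Real.log (wealth d lam bond stock T ω) : ℝ) : EReal)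
  else ⊥

/-- The optimal expected logarithmic utility for the horizon `T` and initial wealth `x`, that is,
the expected logarithmic utility of a log-optimal portfolio. -/
def optimalLogUtility (p d lam x : ℝ) (T : ℕ) : EReal :=
  ⨆ (bond : ℕ → Path T → ℝ) (stock : ℕ → Path T → ℝ) (_ : IsAdmissible d lam x bond stock),
    logUtility p d lam bond stock

/-- The optimal growth rate `limsup_{T → ∞} (1 / T) E[log V_T]`, where `V_T` is the terminal wealth
of the log-optimal portfolio for the horizon `T`. -/
def optimalGrowthRate (p d lam x : ℝ) : EReal :=
  limsup (fun T : ℕ => optimalLogUtility p d lam x T / (T : EReal)) atTop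

/-! ### The ratio of bonds to stocks, and the explicit growth rate -/

/-- The optimal ratio of the wealth in bonds to the wealth in stocks without transaction costs. -/
def cBar (p d : ℝ) : ℝ := (1 - p - p * d) / (p + p * d - d)

/-- The interval in which the ratio `c` is sought when there are transaction costs. -/
def ratioInterval (p d : ℝ) : Set ℝ :=
  if p ≤ 1 / 2 then Ioi (cBar p d)
  else Ioo (cBar p d) ((1 - p - p * d) / (2 * p - 1))

/-- The auxiliary quantity `r(c)`. -/
def rAux (p d c : ℝ) : ℝ :=
  (c * (p + p * d - d) + d * (2 * p - 1)) * (1 - p - p * d - c * (2 * p - 1))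
    / (c * (1 - d) ^ 2 * (1 - p) ^ 2)

/-- The function `F` whose equation `F(c) = lam` determines the ratio `c`. -/
def costOfRatio (p d c : ℝ) : ℝ :=
  if p = 1 / 2 then 1 - c ^ 2 * d ^ ((c + d) * (c - 1) / (c * (1 - d)))
  else 1 - ((c * (p + p * d - d) + d * (2 * p - 1)) / ((1 - d) * (1 - p))) ^ 2
    * rAux p d c ^ (Real.log d / Real.log ((1 - p) / p) - 1)

/-- The net number `k` of upward steps which take the shadow price from the ask price to the
bid price, as a function of the ratio `c`. -/
def netSteps (p d c : ℝ) : ℝ :=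
  if p = 1 / 2 then (c + d) * (c - 1) / (c * (1 - d))
  else Real.log (rAux p d c) / Real.log ((1 - p) / p)

/-- The closed form of the growth rate as a function of the ratio `c`. -/
def growthOfRatio (p d c : ℝ) : ℝ :=
  if p = 1 / 2 then
    c * (1 - d) / (c ^ 2 - d) * Real.log ((c + d) / (Real.sqrt d * (c + 1)))
  else
    (1 - 2 * p) / ((1 - p) * (1 - (p / (1 - p)) ^ (netSteps p d c + 1)))
      * ((1 - p) * Real.log ((c + d) / (c + 1))
        + p * (p / (1 - p)) ^ netSteps p d c
          * Real.log ((c + d) * p / ((c + 1) * (1 - p) * d)))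

/-! ### The coefficients of the expansion -/

/-- The constant `η`. -/
def eta (p d : ℝ) : ℝ :=
  if p = 1 / 2 then Real.log d / (-2 * (1 - d))
  else (2 * p - 1) * Real.log d / ((1 - d) * Real.log ((1 - p) / p))

/-- The optimal growth rate without transaction costs. -/
def growthCoeffZero (p d : ℝ) : ℝ :=
  Real.log ((1 + d) * p ^ p * (1 - p) ^ (1 - p) / d ^ p)

/-- The first-order coefficient. -/
def growthCoeffOne (p d : ℝ) : ℝ :=
  ((p + p * d - d) * (1 - p - p * d)
      - (1 + d) ^ 2 * (1 - p) * p * Real.log ((1 + d) ^ 2 * (1 - p) * p / d))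
    / ((1 - d ^ 2) * ((1 + d) * eta p d - 1))

end

end BinomialMarket

namespace BinomialMarket

noncomputable section

/-! ### Expectations on the path space -/

/-! The growth rate is computed with a shadow price: a process inside the bid-ask spread whose
frictionless log-optimal portfolio buys only when it equals the ask and sells only when it equals
the bid. Such a portfolio is feasible with transaction costs, and no strategy with costs beats it by
more than a bounded amount. For integer `k` the shadow price is `m * g j`. The walk `j` follows the
stock and is reflected at `0` and `k`, and `m` moves only at reflections. The portfolio keeps bonds
to stocks at ratio `c` in units of `m`. It is the numéraire portfolio if the deflator `1 / (c + g
j)` is a martingale, that is, if it is harmonic for the biased walk. Hence it is affine in geometric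
sums of the odds `q = (1 - p) / p`. The reflection at `k` and the spread condition `g k * d ^ k = 1
- lam` give the equations that define `k` and `F`. Since `log y ≤ y - 1` and liquidation costs at
most the factor `1 - lam`, the optimal utility equals the log growth of the shadow wealth up to
`O(1)` (`optimalLogUtility_bounds`). A Poisson equation on the finite state space computes that
growth (`optimalGrowthRate_eq`). The rest is calculus in `c`. `F` increases from `0` to `1` on `I`,
so `c(lam)` exists and is unique; for monotonicity the decisive inequality is `(1 + d) η > 1`
(`one_lt_mul_eta`), which follows from monotonicity of `log x * (1 + x) / (1 - x)`. Both `F` and `G`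
are analytic at `c̄` with `F' ≠ 0` and `G' = R₁ F'`, so `G - R₀ - R₁ F` vanishes to second order
there and is `O(F ^ 2)`. Away from `c̄`, `F` is bounded below and `G` is bounded, which makes the
constant uniform (`exists_abs_sub_le_sq`). Finally `R₁ < 0` is the inequality `z log z > z - 1`. -/

lemma pathProb_nonneg {p : ℝ} (hp0 : 0 ≤ p) (hp1 : p ≤ 1) {T : ℕ} (ω : Path T) :
    0 ≤ pathProb p ω :=
  Finset.prod_nonneg fun i _ => by split_ifs <;> linarith

lemma sum_pathProb (p : ℝ) (T : ℕ) : ∑ ω : Path T, pathProb p ω = 1 := by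
  have h := (Finset.prod_univ_sum (fun _ : Fin T => (Finset.univ : Finset Bool))
    (fun _ b => if b then p else 1 - p)).symm
  rw [Fintype.piFinset_univ] at h
  unfold pathProb
  rw [h]
  simp

lemma expect_const (p a : ℝ) (T : ℕ) : expect p (fun _ : Path T => a) = a := by
  unfold expect
  rw [← Finset.sum_mul, sum_pathProb, one_mul]

lemma expect_mono {p : ℝ} (hp0 : 0 ≤ p) (hp1 : p ≤ 1) {T : ℕ} {X Y : Path T → ℝ}
    (h : ∀ ω, X ω ≤ Y ω) : expect p X ≤ expect p Y :=
  Finset.sum_le_sum fun ω _ => mul_le_mul_of_nonneg_left (h ω) (pathProb_nonneg hp0 hp1 ω)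

lemma expect_add (p : ℝ) {T : ℕ} (X Y : Path T → ℝ) :
    expect p (fun ω => X ω + Y ω) = expect p X + expect p Y := by
  simp [expect, mul_add, Finset.sum_add_distrib]

lemma expect_neg (p : ℝ) {T : ℕ} (X : Path T → ℝ) :
    expect p (fun ω => -X ω) = -expect p X := by
  simp [expect]

/-- Flipping step `i` is an involution of the path space, so each path can be paired with its flip.
-/
lemma two_mul_sum_path {T : ℕ} (i : Fin T) (f : Path T → ℝ) :
    2 * ∑ ω, f ω = ∑ ω, (f (Function.update ω i true) + f (Function.update ω i false)) := by
  have hinv : Function.Involutive (fun ω : Path T => Function.update ω i (!ω i)) := by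
    intro ω
    simp
  have h : ∑ ω, f ω = ∑ ω : Path T, f (Function.update ω i (!ω i)) :=
    (Equiv.sum_comp hinv.toPerm f).symm
  rw [two_mul]
  nth_rewrite 2 [h]
  rw [← Finset.sum_add_distrib]
  refine Finset.sum_congr rfl fun ω _ => ?_
  have hω : Function.update ω i (ω i) = ω := Function.update_eq_self i ω
  cases hb : ω i
  · rw [hb] at hω
    rw [hω, add_comm]; rfl
  · rw [hb] at hω
    rw [hω]; rfl

lemma pathProb_update (p : ℝ) {T : ℕ} (ω : Path T) (i : Fin T) (b : Bool) :
    pathProb p (Function.update ω i b)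
      = (if b then p else 1 - p) * ∏ j ∈ Finset.univ.erase i, if ω j then p else 1 - p := by
  unfold pathProb
  rw [← Finset.mul_prod_erase _ _ (Finset.mem_univ i)]
  congr 1
  · simp
  · refine Finset.prod_congr rfl fun j hj => ?_
    rw [Function.update_of_ne (Finset.ne_of_mem_erase hj)]

/-- Resampling one step leaves the law unchanged. This takes the place of conditional expectations
in the martingale arguments. -/
lemma expect_update (p : ℝ) {T : ℕ} (i : Fin T) (X : Path T → ℝ) :
    expect p X = expect p fun ω => p * X (Function.update ω i true)
      + (1 - p) * X (Function.update ω i false) := by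
  have h1 := two_mul_sum_path i fun ω => pathProb p ω * X ω
  have h2 := two_mul_sum_path i fun ω => pathProb p ω *
    (p * X (Function.update ω i true) + (1 - p) * X (Function.update ω i false))
  unfold expect
  refine mul_left_cancel₀ (two_ne_zero (α := ℝ)) ?_
  rw [h1, h2]
  refine Finset.sum_congr rfl fun ω _ => ?_
  simp only [pathProb_update, Function.update_idem]
  simp only [if_true, Bool.false_eq_true, if_false]
  ring

/-- The expectation of a supermartingale decreases. -/
lemma expect_le_of_supermartingale {p : ℝ} (hp0 : 0 ≤ p) (hp1 : p ≤ 1) {T : ℕ}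
    (Y : ℕ → Path T → ℝ)
    (h : ∀ (t : ℕ) (ht : t < T) (ω : Path T), p * Y (t + 1) (Function.update ω ⟨t, ht⟩ true)
      + (1 - p) * Y (t + 1) (Function.update ω ⟨t, ht⟩ false) ≤ Y t ω) :
    expect p (Y T) ≤ expect p (Y 0) := by
  have key : ∀ t ≤ T, expect p (Y t) ≤ expect p (Y 0) := by
    intro t
    induction t with
    | zero => exact fun _ => le_rfl
    | succ t ih =>
      intro ht
      refine le_trans ?_ (ih (by omega))
      rw [expect_update p ⟨t, ht⟩ (Y (t + 1))]
      exact expect_mono hp0 hp1 fun ω => h t ht ω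
  exact key T le_rfl

lemma expect_eq_of_martingale {p : ℝ} (hp0 : 0 ≤ p) (hp1 : p ≤ 1) {T : ℕ}
    (Y : ℕ → Path T → ℝ)
    (h : ∀ (t : ℕ) (ht : t < T) (ω : Path T), p * Y (t + 1) (Function.update ω ⟨t, ht⟩ true)
      + (1 - p) * Y (t + 1) (Function.update ω ⟨t, ht⟩ false) = Y t ω) :
    expect p (Y T) = expect p (Y 0) := by
  refine le_antisymm (expect_le_of_supermartingale hp0 hp1 Y fun t ht ω => (h t ht ω).le) ?_
  have := expect_le_of_supermartingale hp0 hp1 (fun t ω => -Y t ω) fun t ht ω => by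
    rw [← h t ht ω]; linarith
  rw [expect_neg, expect_neg] at this
  linarith

/-! ### The stock price -/

lemma stockPrice_zero (d : ℝ) {T : ℕ} (ω : Path T) : stockPrice d 0 ω = 1 := by
  simp [stockPrice]

lemma stockPrice_pos {d : ℝ} (hd : 0 < d) {T : ℕ} (t : ℕ) (ω : Path T) :
    0 < stockPrice d t ω :=
  Finset.prod_pos fun i _ => by split_ifs <;> positivity

lemma stockPrice_succ (d : ℝ) {T t : ℕ} (ht : t < T) (ω : Path T) :
    stockPrice d (t + 1) ω = stockPrice d t ω * if ω ⟨t, ht⟩ then d⁻¹ else d := by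
  unfold stockPrice
  rw [← Finset.mul_prod_erase _ _ (Finset.mem_univ (⟨t, ht⟩ : Fin T)),
    ← Finset.mul_prod_erase Finset.univ (fun i : Fin T => if (i : ℕ) < t then _ else _)
      (Finset.mem_univ (⟨t, ht⟩ : Fin T))]
  simp only [lt_add_iff_pos_right, zero_lt_one, if_true, lt_irrefl, if_false, one_mul]
  rw [mul_comm]
  congr 1
  refine Finset.prod_congr rfl fun j hj => ?_
  have : (j : ℕ) ≠ t := fun h => Finset.ne_of_mem_erase hj (Fin.ext h)
  have h2 : (j : ℕ) < t + 1 ↔ (j : ℕ) < t := by omega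
  simp only [h2]

lemma isAdaptedProcess_stockPrice (d : ℝ) {T : ℕ} :
    IsAdaptedProcess (stockPrice d : ℕ → Path T → ℝ) := by
  intro t _ ω ω' h
  refine Finset.prod_congr rfl fun i _ => ?_
  by_cases hi : (i : ℕ) < t
  · rw [h i hi]
  · simp [hi]

lemma IsAdaptedProcess.update {T : ℕ} {X : ℕ → Path T → ℝ} (hX : IsAdaptedProcess X) {t : ℕ}
    (ht : t < T) (ω : Path T) (b : Bool) :
    X t (Function.update ω ⟨t, ht⟩ b) = X t ω :=
  hX t ht.le _ _ fun i hi => Function.update_of_ne (fun h => by simp [h] at hi) _ _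

/-! ### The shadow market

The shadow price is `S̃ = m * g j`, where `j ∈ {0, …, k}` is a reflected random walk driven by the
stock price `S`, and `m = S * d ^ j`. -/

/-- The state of the reflected random walk after one step. -/
def nextState (k j : ℕ) (b : Bool) : ℕ := if b then min (j + 1) k else j - 1

/-- The shadow price after one step from the state `j`, in units of `m`. -/
def nextPrice (d : ℝ) (k : ℕ) (g : ℕ → ℝ) (j : ℕ) (b : Bool) : ℝ :=
  if b then (if j < k then g (j + 1) else g k * d⁻¹) else (if j = 0 then d else g (j - 1))

/-- The reflected random walk on `{0, …, k}`. -/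
def walk (k : ℕ) {T : ℕ} : ℕ → Path T → ℕ
  | 0, _ => 0
  | t + 1, ω => if h : t < T then nextState k (walk k t ω) (ω ⟨t, h⟩) else walk k t ω

/-- The unit `m` in which the shadow price is measured. -/
def priceUnit (d : ℝ) (k : ℕ) {T : ℕ} (t : ℕ) (ω : Path T) : ℝ :=
  stockPrice d t ω * d ^ walk k t ω

/-- The shadow price. -/
def shadowPrice (d : ℝ) (k : ℕ) (g : ℕ → ℝ) {T : ℕ} (t : ℕ) (ω : Path T) : ℝ :=
  priceUnit d k t ω * g (walk k t ω)

/-- The wealth, in terms of the shadow price, of the strategy which keeps the ratio `c` between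
bonds and stocks in units of `m`. -/
def shadowWealth (d c x : ℝ) (k : ℕ) (g : ℕ → ℝ) {T : ℕ} : ℕ → Path T → ℝ
  | 0, _ => x
  | t + 1, ω => if h : t < T then shadowWealth d c x k g t ω
      * ((c + nextPrice d k g (walk k t ω) (ω ⟨t, h⟩)) / (c + g (walk k t ω)))
      else shadowWealth d c x k g t ω

/-- The number of bonds held by the optimal strategy. -/
def shadowBond (d c x : ℝ) (k : ℕ) (g : ℕ → ℝ) {T : ℕ} (t : ℕ) (ω : Path T) : ℝ :=
  c * (shadowWealth d c x k g t ω / (c + g (walk k t ω)))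

/-- The number of stocks held by the optimal strategy. -/
def shadowStock (d c x : ℝ) (k : ℕ) (g : ℕ → ℝ) {T : ℕ} (t : ℕ) (ω : Path T) : ℝ :=
  shadowWealth d c x k g t ω / (c + g (walk k t ω)) / priceUnit d k t ω

/-- The conditions under which `g` describes a shadow price for the bid-ask process
`((1 - lam) S, S)` whose log-optimal portfolio has the ratio `c` between bonds and stocks. -/
structure IsShadowPrice (p d lam c : ℝ) (k : ℕ) (g : ℕ → ℝ) : Prop where
  ratio_pos : 0 < c
  price_pos : ∀ j ≤ k, 0 < g j
  price_zero : g 0 = 1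
  price_last : g k * d ^ k = 1 - lam
  bid_le : ∀ j ≤ k, 1 - lam ≤ g j * d ^ j
  le_ask : ∀ j ≤ k, g j * d ^ j ≤ 1
  harmonic : ∀ j ≤ k, p * (c + nextPrice d k g j true)⁻¹
    + (1 - p) * (c + nextPrice d k g j false)⁻¹ = (c + g j)⁻¹

/-- `ψ` solves the Poisson equation for the logarithmic growth of the shadow wealth, with
growth rate `R`. -/
def IsPotential (p d c : ℝ) (k : ℕ) (g : ℕ → ℝ) (R : ℝ) (ψ : ℕ → ℝ) : Prop :=
  ∀ j ≤ k, p * (Real.log (c + nextPrice d k g j true) + ψ (nextState k j true))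
    + (1 - p) * (Real.log (c + nextPrice d k g j false) + ψ (nextState k j false))
    = Real.log (c + g j) + ψ j + R

lemma nextState_le {k j : ℕ} (hj : j ≤ k) (b : Bool) : nextState k j b ≤ k := by
  unfold nextState; split_ifs <;> omega

lemma walk_le (k : ℕ) {T : ℕ} (t : ℕ) (ω : Path T) : walk k t ω ≤ k := by
  induction t with
  | zero => simp [walk]
  | succ t ih =>
    unfold walk
    split_ifs
    · exact nextState_le ih _
    · exact ih

lemma walk_succ (k : ℕ) {T t : ℕ} (ht : t < T) (ω : Path T) :
    walk k (t + 1) ω = nextState k (walk k t ω) (ω ⟨t, ht⟩) := by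
  simp [walk, ht]

lemma shadowWealth_succ (d c x : ℝ) (k : ℕ) (g : ℕ → ℝ) {T t : ℕ} (ht : t < T) (ω : Path T) :
    shadowWealth d c x k g (t + 1) ω = shadowWealth d c x k g t ω
      * ((c + nextPrice d k g (walk k t ω) (ω ⟨t, ht⟩)) / (c + g (walk k t ω))) := by
  simp [shadowWealth, ht]

lemma walk_congr (k : ℕ) {T : ℕ} {t : ℕ} (ht : t ≤ T) {ω ω' : Path T}
    (h : ∀ i : Fin T, (i : ℕ) < t → ω i = ω' i) : walk k t ω = walk k t ω' := by
  induction t with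
  | zero => simp [walk]
  | succ t ih =>
    rw [walk_succ k ht, walk_succ k ht, ih (by omega) fun i hi => h i (by omega),
      h ⟨t, ht⟩ (by simp)]

lemma walk_update (k : ℕ) {T t : ℕ} (ht : t < T) (ω : Path T) (b : Bool) :
    walk k t (Function.update ω ⟨t, ht⟩ b) = walk k t ω :=
  walk_congr k ht.le fun i hi => Function.update_of_ne (fun h => by simp [h] at hi) _ _

lemma isAdaptedProcess_priceUnit (d : ℝ) (k : ℕ) {T : ℕ} :
    IsAdaptedProcess (priceUnit d k : ℕ → Path T → ℝ) := by
  intro t ht ω ω' h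
  unfold priceUnit
  rw [walk_congr k ht h, isAdaptedProcess_stockPrice d t ht ω ω' h]

lemma isAdaptedProcess_shadowWealth (d c x : ℝ) (k : ℕ) (g : ℕ → ℝ) {T : ℕ} :
    IsAdaptedProcess (shadowWealth d c x k g : ℕ → Path T → ℝ) := by
  intro t
  induction t with
  | zero => exact fun _ _ _ _ => rfl
  | succ t ih =>
    intro ht ω ω' h
    have h' : ∀ i : Fin T, (i : ℕ) < t → ω i = ω' i := fun i hi => h i (by omega)
    rw [shadowWealth_succ _ _ _ _ _ ht, shadowWealth_succ _ _ _ _ _ ht,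
      ih (by omega) ω ω' h', walk_congr k (by omega) h', h ⟨t, ht⟩ (by simp)]

lemma isAdaptedProcess_shadowBond (d c x : ℝ) (k : ℕ) (g : ℕ → ℝ) {T : ℕ} :
    IsAdaptedProcess (shadowBond d c x k g : ℕ → Path T → ℝ) := by
  intro t ht ω ω' h
  unfold shadowBond
  rw [walk_congr k ht h, isAdaptedProcess_shadowWealth d c x k g t ht ω ω' h]

lemma isAdaptedProcess_shadowStock (d c x : ℝ) (k : ℕ) (g : ℕ → ℝ) {T : ℕ} :
    IsAdaptedProcess (shadowStock d c x k g : ℕ → Path T → ℝ) := by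
  intro t ht ω ω' h
  unfold shadowStock
  rw [walk_congr k ht h, isAdaptedProcess_shadowWealth d c x k g t ht ω ω' h,
    isAdaptedProcess_priceUnit d k t ht ω ω' h]

lemma priceUnit_zero (d : ℝ) (k : ℕ) {T : ℕ} (ω : Path T) : priceUnit d k 0 ω = 1 := by
  simp [priceUnit, stockPrice_zero, walk]

lemma priceUnit_pos {d : ℝ} (hd : 0 < d) (k : ℕ) {T : ℕ} (t : ℕ) (ω : Path T) :
    0 < priceUnit d k t ω :=
  mul_pos (stockPrice_pos hd t ω) (pow_pos hd _)

/-- The factor by which the unit `m` changes in one step. -/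
def unitFactor (d : ℝ) (k j : ℕ) (b : Bool) : ℝ :=
  if b then (if j < k then 1 else d⁻¹) else (if j = 0 then d else 1)

/-- A move of the walk offsets the move of `S` exactly in `S * d ^ j`, so `m` changes only when the
walk is reflected. -/
lemma priceUnit_succ {d : ℝ} (hd : 0 < d) (k : ℕ) {T t : ℕ} (ht : t < T) (ω : Path T) :
    priceUnit d k (t + 1) ω
      = priceUnit d k t ω * unitFactor d k (walk k t ω) (ω ⟨t, ht⟩) := by
  have hj := walk_le k t ω
  unfold priceUnit
  rw [walk_succ k ht, stockPrice_succ d ht]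
  generalize walk k t ω = j at hj
  cases ω ⟨t, ht⟩
  · rcases j with _ | j
    · simp [nextState, unitFactor]
    · simp [nextState, unitFactor]; ring
  · rcases hj.lt_or_eq with h | h
    · simp [nextState, unitFactor, h]; field_simp; ring
    · simp [nextState, unitFactor, h]; ring

/-! ### Optimality of the shadow strategy and its growth rate -/

namespace IsShadowPrice

variable {p d lam c : ℝ} {k : ℕ} {g : ℕ → ℝ}

/-- Continuity across a reflection: the new price may be read in the old unit or in the new one. At
the lower end this uses `g 0 = 1`. -/
lemma unitFactor_mul (hg : IsShadowPrice p d lam c k g) {j : ℕ} (hj : j ≤ k) (b : Bool) :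
    unitFactor d k j b * g (nextState k j b) = nextPrice d k g j b := by
  cases b
  · rcases j with _ | j
    · simp [nextState, unitFactor, nextPrice, hg.price_zero]
    · simp [nextState, unitFactor, nextPrice]
  · rcases hj.lt_or_eq with h | h
    · simp [nextState, unitFactor, nextPrice, h]
    · simp [nextState, unitFactor, nextPrice, h, mul_comm]

lemma nextPrice_pos (hg : IsShadowPrice p d lam c k g) (hd : 0 < d) {j : ℕ} (hj : j ≤ k)
    (b : Bool) : 0 < nextPrice d k g j b := by
  rw [← hg.unitFactor_mul hj]
  refine mul_pos ?_ (hg.price_pos _ (nextState_le hj b))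
  unfold unitFactor
  split_ifs <;> positivity

lemma shadowPrice_succ (hg : IsShadowPrice p d lam c k g) (hd : 0 < d) {T t : ℕ} (ht : t < T)
    (ω : Path T) : shadowPrice d k g (t + 1) ω
      = priceUnit d k t ω * nextPrice d k g (walk k t ω) (ω ⟨t, ht⟩) := by
  unfold shadowPrice
  rw [priceUnit_succ hd k ht, walk_succ k ht, ← hg.unitFactor_mul (walk_le k t ω), mul_assoc]

lemma add_price_pos (hg : IsShadowPrice p d lam c k g) {T : ℕ} (t : ℕ) (ω : Path T) :
    0 < c + g (walk k t ω) :=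
  add_pos hg.ratio_pos (hg.price_pos _ (walk_le k t ω))

lemma shadowWealth_pos (hg : IsShadowPrice p d lam c k g) (hd : 0 < d) {x : ℝ} (hx : 0 < x)
    {T : ℕ} (t : ℕ) (ω : Path T) : 0 < shadowWealth d c x k g t ω := by
  induction t with
  | zero => exact hx
  | succ t ih =>
    unfold shadowWealth
    split_ifs with h
    · exact mul_pos ih (div_pos (add_pos hg.ratio_pos (hg.nextPrice_pos hd (walk_le k t ω) _))
        (hg.add_price_pos t ω))
    · exact ih

lemma shadowPrice_le (hg : IsShadowPrice p d lam c k g) (hd : 0 < d) {T : ℕ} (t : ℕ)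
    (ω : Path T) : shadowPrice d k g t ω ≤ stockPrice d t ω := by
  have h1 := hg.le_ask _ (walk_le k t ω)
  have h2 := mul_le_mul_of_nonneg_left h1 (stockPrice_pos hd t ω).le
  unfold shadowPrice priceUnit
  linarith

lemma le_shadowPrice (hg : IsShadowPrice p d lam c k g) (hd : 0 < d) {T : ℕ} (t : ℕ)
    (ω : Path T) : (1 - lam) * stockPrice d t ω ≤ shadowPrice d k g t ω := by
  have h1 := hg.bid_le _ (walk_le k t ω)
  have h2 := mul_le_mul_of_nonneg_left h1 (stockPrice_pos hd t ω).le
  unfold shadowPrice priceUnit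
  linarith

lemma shadowBond_add (hg : IsShadowPrice p d lam c k g) (hd : 0 < d) (x : ℝ) {T : ℕ} (t : ℕ)
    (ω : Path T) : shadowBond d c x k g t ω + shadowStock d c x k g t ω * shadowPrice d k g t ω
      = shadowWealth d c x k g t ω := by
  have h1 := (hg.add_price_pos t ω).ne'
  have h2 := (priceUnit_pos hd k t ω).ne'
  unfold shadowBond shadowStock shadowPrice
  field_simp

/-- A trade at a price between the bid and the ask price which is self-financing for the bid-ask
process is self-financing for the shadow price. -/
lemma trade_le (hg : IsShadowPrice p d lam c k g) (hd : 0 < d) {T : ℕ} (t : ℕ) (ω : Path T)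
    {a b : ℝ} (h1 : a + b * stockPrice d t ω ≤ 0)
    (h2 : a + b * ((1 - lam) * stockPrice d t ω) ≤ 0) :
    a + b * shadowPrice d k g t ω ≤ 0 := by
  have h3 := hg.shadowPrice_le hd t ω
  have h4 := hg.le_shadowPrice hd t ω
  rcases le_total 0 b with hb | hb
  · nlinarith [mul_le_mul_of_nonneg_left h3 hb]
  · nlinarith [mul_le_mul_of_nonpos_left h4 hb]

lemma wealth_le (hg : IsShadowPrice p d lam c k g) (hd : 0 < d) {T : ℕ}
    (bond stock : ℕ → Path T → ℝ) (t : ℕ) (ω : Path T) :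
    wealth d lam bond stock t ω ≤ bond t ω + stock t ω * shadowPrice d k g t ω := by
  have h3 := hg.shadowPrice_le hd t ω
  have h4 := hg.le_shadowPrice hd t ω
  unfold wealth
  rcases le_total 0 (stock t ω) with hb | hb
  · rw [max_eq_left hb, max_eq_right (by linarith)]
    nlinarith [mul_le_mul_of_nonneg_left h4 hb]
  · rw [max_eq_right hb, max_eq_left (by linarith)]
    nlinarith [mul_le_mul_of_nonpos_left h3 hb]

/-- The inverse of the shadow wealth is a deflator for the shadow price. -/
lemma deflator (hg : IsShadowPrice p d lam c k g) (hd : 0 < d) {x : ℝ} (hx : 0 < x) {T t : ℕ}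
    (ht : t < T) (ω : Path T) (a b : ℝ) :
    p * ((a + b * shadowPrice d k g (t + 1) (Function.update ω ⟨t, ht⟩ true))
        / shadowWealth d c x k g (t + 1) (Function.update ω ⟨t, ht⟩ true))
      + (1 - p) * ((a + b * shadowPrice d k g (t + 1) (Function.update ω ⟨t, ht⟩ false))
        / shadowWealth d c x k g (t + 1) (Function.update ω ⟨t, ht⟩ false))
      = (a + b * shadowPrice d k g t ω) / shadowWealth d c x k g t ω := by
  have hj := walk_le k t ω
  have hm := priceUnit_pos hd k t ω
  have hV := hg.shadowWealth_pos hd hx t ω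
  have hup := add_pos hg.ratio_pos (hg.nextPrice_pos hd hj true)
  have hdn := add_pos hg.ratio_pos (hg.nextPrice_pos hd hj false)
  have hgj := hg.add_price_pos t ω
  have hh := hg.harmonic _ hj
  simp only [hg.shadowPrice_succ hd ht, shadowWealth_succ _ _ _ _ _ ht, walk_update,
    (isAdaptedProcess_priceUnit d k).update ht, (isAdaptedProcess_shadowWealth d c x k g).update ht,
    Function.update_self]
  unfold shadowPrice
  generalize walk k t ω = j at *
  generalize nextPrice d k g j true = u at *
  generalize nextPrice d k g j false = v at *
  generalize priceUnit d k t ω = m at *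
  generalize shadowWealth d c x k g t ω = V at *
  -- The deflated value of any portfolio is affine in `1 / (c + w)`, so harmonicity of this single
  -- quantity makes bond and stock deflated martingales together.
  have e1 : ∀ w : ℝ, 0 < c + w → (a + b * (m * w)) / (V * ((c + w) / (c + g j)))
      = (c + g j) / V * ((a - b * m * c) * (c + w)⁻¹ + b * m) := by
    intro w hw
    field_simp
    ring
  rw [e1 u hup, e1 v hdn]
  have e2 : p * ((c + g j) / V * ((a - b * m * c) * (c + u)⁻¹ + b * m))
      + (1 - p) * ((c + g j) / V * ((a - b * m * c) * (c + v)⁻¹ + b * m))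
      = (c + g j) / V * ((a - b * m * c) * (p * (c + u)⁻¹ + (1 - p) * (c + v)⁻¹) + b * m) := by
    ring
  rw [e2, hh]
  field_simp
  ring

/-- The shadow wealth is a numéraire portfolio. -/
lemma expect_wealth_div_le (hg : IsShadowPrice p d lam c k g) (hd : 0 < d) (hp0 : 0 ≤ p)
    (hp1 : p ≤ 1) {x : ℝ} (hx : 0 < x) {T : ℕ} {bond stock : ℕ → Path T → ℝ}
    (h : IsAdmissible d lam x bond stock) :
    expect p (fun ω => wealth d lam bond stock T ω / shadowWealth d c x k g T ω) ≤ 1 := by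
  let Y : ℕ → Path T → ℝ := fun t ω =>
    (bond t ω + stock t ω * shadowPrice d k g t ω) / shadowWealth d c x k g t ω
  have h1 : expect p (fun ω => wealth d lam bond stock T ω / shadowWealth d c x k g T ω)
      ≤ expect p (Y T) := expect_mono hp0 hp1 fun ω =>
    div_le_div_of_nonneg_right (hg.wealth_le hd bond stock T ω) (hg.shadowWealth_pos hd hx T ω).le
  have h2 : expect p (Y T) ≤ expect p (Y 0) := by
    refine expect_le_of_supermartingale hp0 hp1 Y fun t ht ω => ?_
    refine le_trans ?_ (hg.deflator hd hx ht ω (bond t ω) (stock t ω)).le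
    -- The rebalancing at time `t + 1` cannot raise the value at the shadow price, so the old
    -- holdings dominate, and for them the deflator identity holds.
    have key : ∀ b, Y (t + 1) (Function.update ω ⟨t, ht⟩ b)
        ≤ (bond t ω + stock t ω * shadowPrice d k g (t + 1) (Function.update ω ⟨t, ht⟩ b))
          / shadowWealth d c x k g (t + 1) (Function.update ω ⟨t, ht⟩ b) := by
      intro b
      refine div_le_div_of_nonneg_right ?_ (hg.shadowWealth_pos hd hx _ _).le
      have h3 := hg.trade_le hd (t + 1) _ (h.self_financing_ask (t + 1) ht
        (Function.update ω ⟨t, ht⟩ b)) (h.self_financing_bid (t + 1) ht _)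
      simp only [previous, h.adapted_bond.update ht, h.adapted_stock.update ht] at h3
      linarith
    exact add_le_add (mul_le_mul_of_nonneg_left (key true) hp0)
      (mul_le_mul_of_nonneg_left (key false) (by linarith))
  have h3 : expect p (Y 0) ≤ expect p (fun _ : Path T => 1) := by
    refine expect_mono hp0 hp1 fun ω => ?_
    have h4 := hg.trade_le hd 0 ω (h.self_financing_ask 0 (Nat.zero_le _) ω)
      (h.self_financing_bid 0 (Nat.zero_le _) ω)
    simp only [previous] at h4
    exact (div_le_one hx).2 (by linarith)
  rw [expect_const] at h3
  linarith

lemma shadowStock_pos (hg : IsShadowPrice p d lam c k g) (hd : 0 < d) {x : ℝ} (hx : 0 < x)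
    {T : ℕ} (t : ℕ) (ω : Path T) : 0 < shadowStock d c x k g t ω :=
  div_pos (div_pos (hg.shadowWealth_pos hd hx t ω) (hg.add_price_pos t ω)) (priceUnit_pos hd k t ω)

lemma shadowBond_pos (hg : IsShadowPrice p d lam c k g) (hd : 0 < d) {x : ℝ} (hx : 0 < x)
    {T : ℕ} (t : ℕ) (ω : Path T) : 0 < shadowBond d c x k g t ω :=
  mul_pos hg.ratio_pos (div_pos (hg.shadowWealth_pos hd hx t ω) (hg.add_price_pos t ω))

/-- The liquidation value of the optimal strategy is comparable with the shadow wealth. -/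
lemma le_wealth_shadow (hg : IsShadowPrice p d lam c k g) (hd : 0 < d) (hl0 : 0 ≤ lam)
    (hl1 : lam ≤ 1) {x : ℝ} (hx : 0 < x) {T : ℕ} (t : ℕ) (ω : Path T) :
    (1 - lam) * shadowWealth d c x k g t ω
      ≤ wealth d lam (shadowBond d c x k g) (shadowStock d c x k g) t ω := by
  have hs := hg.shadowStock_pos hd hx t ω
  have hb := hg.shadowBond_pos hd hx t ω
  have h3 := hg.shadowPrice_le hd t ω
  unfold wealth
  rw [max_eq_left hs.le, max_eq_right (by linarith), ← hg.shadowBond_add hd x t ω]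
  have h4 := mul_le_mul_of_nonneg_left h3 (mul_nonneg hs.le (sub_nonneg.2 hl1))
  nlinarith [mul_nonneg hl0 hb.le]

lemma shadow_selfFinancing (hg : IsShadowPrice p d lam c k g) (hd : 0 < d) (x : ℝ)
    {T t : ℕ} (ht : t < T) (ω : Path T) :
    shadowBond d c x k g (t + 1) ω - shadowBond d c x k g t ω
      + (shadowStock d c x k g (t + 1) ω - shadowStock d c x k g t ω)
        * shadowPrice d k g (t + 1) ω = 0 := by
  have h1 := hg.shadowBond_add hd x (t + 1) ω
  have h2 := (hg.add_price_pos t ω).ne'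
  have h3 := (priceUnit_pos hd k t ω).ne'
  have h4 : shadowBond d c x k g t ω + shadowStock d c x k g t ω * shadowPrice d k g (t + 1) ω
      = shadowWealth d c x k g (t + 1) ω := by
    rw [hg.shadowPrice_succ hd ht, shadowWealth_succ _ _ _ _ _ ht]
    unfold shadowBond shadowStock
    field_simp
  linarith

/-- The optimal strategy buys only if the shadow price is the ask price, and sells only if it is
the bid price. -/
lemma shadowStock_succ (hg : IsShadowPrice p d lam c k g) (hd : 0 < d) (hd1 : d < 1) {x : ℝ}
    (hx : 0 < x) {T t : ℕ} (ht : t < T) (ω : Path T) :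
    shadowStock d c x k g (t + 1) ω = shadowStock d c x k g t ω
    ∨ (shadowStock d c x k g t ω ≤ shadowStock d c x k g (t + 1) ω
      ∧ shadowPrice d k g (t + 1) ω = stockPrice d (t + 1) ω)
    ∨ (shadowStock d c x k g (t + 1) ω ≤ shadowStock d c x k g t ω
      ∧ shadowPrice d k g (t + 1) ω = (1 - lam) * stockPrice d (t + 1) ω) := by
  have hj := walk_le k t ω
  have hm := priceUnit_pos hd k t ω
  have hV := hg.shadowWealth_pos hd hx t ω
  have hgj := hg.add_price_pos t ω
  have hc := hg.ratio_pos
  have hw := walk_succ k ht ω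
  have hwl := walk_le k (t + 1) ω
  have hgj' := hg.add_price_pos (t + 1) ω
  -- By the consistency of prices the factor is `1` unless the walk is reflected; only then is there
  -- a trade.
  have e : shadowStock d c x k g (t + 1) ω = shadowStock d c x k g t ω
      * ((c + nextPrice d k g (walk k t ω) (ω ⟨t, ht⟩))
        / (unitFactor d k (walk k t ω) (ω ⟨t, ht⟩) * (c + g (walk k (t + 1) ω)))) := by
    unfold shadowStock
    rw [shadowWealth_succ _ _ _ _ _ ht, priceUnit_succ hd k ht]
    have : unitFactor d k (walk k t ω) (ω ⟨t, ht⟩) ≠ 0 := by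
      unfold unitFactor; split_ifs <;> positivity
    field_simp
  have hs := hg.shadowStock_pos hd hx t ω
  rw [e]
  have hprice : shadowPrice d k g (t + 1) ω
      = stockPrice d (t + 1) ω * (g (walk k (t + 1) ω) * d ^ walk k (t + 1) ω) := by
    unfold shadowPrice priceUnit; ring
  rw [hprice]
  generalize walk k (t + 1) ω = j' at *
  generalize walk k t ω = j at *
  cases hb : ω ⟨t, ht⟩
  · rcases j with _ | j
    · right; left
      have h0 : j' = 0 := by rw [hw, hb]; simp [nextState]
      subst h0
      simp only [nextPrice, unitFactor, hg.price_zero]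
      refine ⟨?_, by simp⟩
      -- At the lower reflection the factor is `(c + d) / (d * (c + 1))`, which is at least `1`
      -- because `d < 1`: stock is bought at the ask.
      refine le_mul_of_one_le_right hs.le ?_
      simp only [Bool.false_eq_true, if_false, if_true]
      rw [one_le_div (by positivity)]
      nlinarith
    · left
      have h0 : j' = j := by rw [hw, hb]; simp [nextState]
      subst h0
      simp only [nextPrice, unitFactor]
      simp [hgj'.ne']
  · rcases hj.lt_or_eq with h | h
    · left
      have h0 : j' = j + 1 := by rw [hw, hb]; simp [nextState]; omega
      subst h0
      simp [nextPrice, unitFactor, h, hgj'.ne']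
    · right; right
      have h0 : j' = k := by rw [hw, hb]; simp [nextState]; omega
      subst h0
      rw [hg.price_last]
      refine ⟨?_, mul_comm _ _⟩
      -- At the upper reflection the factor is `(c + g k / d) / ((c + g k) / d)`, at most `1`: stock
      -- is sold at the bid.
      refine mul_le_of_le_one_right hs.le ?_
      simp only [nextPrice, unitFactor, h, if_true, lt_irrefl, if_false]
      rw [div_le_one (by positivity)]
      have : 1 ≤ d⁻¹ := (one_le_inv₀ hd).2 hd1.le
      nlinarith

lemma isAdmissible (hg : IsShadowPrice p d lam c k g) (hd : 0 < d) (hd1 : d < 1)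
    (hl0 : 0 ≤ lam) (hl1 : lam ≤ 1) {x : ℝ} (hx : 0 < x) {T : ℕ} :
    IsAdmissible d lam x (T := T) (shadowBond d c x k g) (shadowStock d c x k g) := by
  have key : ∀ t ≤ T, ∀ ω : Path T,
      (shadowBond d c x k g t ω - previous x (shadowBond d c x k g) t ω
        + (shadowStock d c x k g t ω - previous 0 (shadowStock d c x k g) t ω)
          * stockPrice d t ω ≤ 0) ∧
      (shadowBond d c x k g t ω - previous x (shadowBond d c x k g) t ω
        + (shadowStock d c x k g t ω - previous 0 (shadowStock d c x k g) t ω)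
          * ((1 - lam) * stockPrice d t ω) ≤ 0) := by
    intro t ht ω
    have hS := stockPrice_pos hd t ω
    -- The walk starts at `0`, where the shadow price is the ask price, so the initial purchase out
    -- of `(x, 0)` is affordable.
    rcases t with _ | t
    · have h1 := hg.shadowBond_add hd x 0 ω
      have h2 : shadowPrice d k g 0 ω = 1 := by
        simp [shadowPrice, priceUnit_zero, walk, hg.price_zero]
      have h3 := hg.shadowStock_pos hd hx 0 ω
      have h4 : shadowWealth d c x k g 0 ω = x := rfl
      rw [h2, h4] at h1
      simp only [previous, stockPrice_zero]
      constructor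
      · linarith
      · nlinarith
    · have h1 := hg.shadow_selfFinancing hd x ht ω
      simp only [previous]
      rcases hg.shadowStock_succ hd hd1 hx ht ω with h | ⟨h, h'⟩ | ⟨h, h'⟩
      · rw [h, sub_self, zero_mul, add_zero] at h1
        rw [h, h1]
        simp
      · rw [h'] at h1
        refine ⟨h1.le, ?_⟩
        nlinarith [mul_nonneg (mul_nonneg (sub_nonneg.2 h) hS.le) hl0]
      · rw [h'] at h1
        refine ⟨?_, h1.le⟩
        nlinarith [mul_nonneg (mul_nonneg (sub_nonneg.2 h) hS.le) hl0]
  refine ⟨isAdaptedProcess_shadowBond d c x k g, isAdaptedProcess_shadowStock d c x k g,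
    fun t ht ω => (key t ht ω).1, fun t ht ω => (key t ht ω).2, fun t _ ω => ?_⟩
  refine le_trans ?_ (hg.le_wealth_shadow hd hl0 hl1 hx t ω)
  exact mul_nonneg (by linarith) (hg.shadowWealth_pos hd hx t ω).le

/-- The expected logarithm of the shadow wealth grows linearly, up to a bounded function. -/
lemma expect_log_shadowWealth (hg : IsShadowPrice p d lam c k g) (hd : 0 < d) (hp0 : 0 ≤ p)
    (hp1 : p ≤ 1) {x : ℝ} (hx : 0 < x) {R : ℝ} {ψ : ℕ → ℝ} (hψ : IsPotential p d c k g R ψ)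
    (T : ℕ) : expect p (fun ω : Path T => Real.log (shadowWealth d c x k g T ω) + ψ (walk k T ω))
      = Real.log x + ψ 0 + R * T := by
  -- The Poisson equation says exactly that this compensated logarithm is a martingale.
  let Y : ℕ → Path T → ℝ := fun t ω =>
    Real.log (shadowWealth d c x k g t ω) + ψ (walk k t ω) + -(R * t)
  have h := expect_eq_of_martingale hp0 hp1 Y fun t ht ω => by
    have hj := walk_le k t ω
    have hψj := hψ _ hj
    have hlog : ∀ b, Real.log (shadowWealth d c x k g t ω
        * ((c + nextPrice d k g (walk k t ω) b) / (c + g (walk k t ω))))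
        = Real.log (shadowWealth d c x k g t ω)
          + (Real.log (c + nextPrice d k g (walk k t ω) b) - Real.log (c + g (walk k t ω))) := by
      intro b
      have h1 := (hg.shadowWealth_pos hd hx t ω).ne'
      have h2 := (add_pos hg.ratio_pos (hg.nextPrice_pos hd hj b)).ne'
      have h3 := (hg.add_price_pos t ω).ne'
      rw [Real.log_mul h1 (div_ne_zero h2 h3), Real.log_div h2 h3]
    simp only [Y, shadowWealth_succ _ _ _ _ _ ht, walk_succ _ ht, walk_update,
      (isAdaptedProcess_shadowWealth d c x k g).update ht, Function.update_self, hlog]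
    push_cast
    linarith
  have h0 : Y 0 = fun _ => Real.log x + ψ 0 := by
    funext ω
    simp [Y, shadowWealth, walk]
  simp only [Y] at h
  rw [expect_add, expect_const] at h
  have h0' : expect p (fun ω : Path T => Real.log (shadowWealth d c x k g 0 ω) + ψ (walk k 0 ω)
      + -(R * ((0 : ℕ) : ℝ))) = Real.log x + ψ 0 := by
    have := expect_const p (Real.log x + ψ 0) T
    rw [← h0] at this
    exact this
  linarith

/-- Below, the shadow strategy is used and only the final liquidation costs the factor `1 - lam`.
Above, `log y ≤ y - 1` is applied to the quotient of the wealths, whose expectation is at most `1`.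
-/
lemma optimalLogUtility_bounds (hg : IsShadowPrice p d lam c k g) (hd : 0 < d) (hd1 : d < 1)
    (hl0 : 0 < lam) (hl1 : lam < 1) (hp0 : 0 ≤ p) (hp1 : p ≤ 1) {x : ℝ} (hx : 0 < x) (T : ℕ) :
    ((Real.log (1 - lam) + expect p (fun ω : Path T => Real.log (shadowWealth d c x k g T ω)) : ℝ)
        : EReal) ≤ optimalLogUtility p d lam x T
    ∧ optimalLogUtility p d lam x T
      ≤ ((expect p (fun ω : Path T => Real.log (shadowWealth d c x k g T ω)) : ℝ) : EReal) := by
  constructor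
  · refine le_trans ?_ (le_iSup_of_le (shadowBond d c x k g) (le_iSup_of_le
      (shadowStock d c x k g) (le_iSup_of_le (hg.isAdmissible hd hd1 hl0.le hl1.le hx) le_rfl)))
    have hV := hg.shadowWealth_pos hd hx (T := T) T
    have hl : 0 < 1 - lam := by linarith
    have hW := hg.le_wealth_shadow hd hl0.le hl1.le hx (T := T) T
    unfold logUtility
    rw [if_pos fun ω => lt_of_lt_of_le (mul_pos hl (hV ω)) (hW ω), EReal.coe_le_coe_iff,
      ← expect_const p (Real.log (1 - lam)) T, ← expect_add]
    refine expect_mono hp0 hp1 fun ω => ?_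
    rw [← Real.log_mul hl.ne' (hV ω).ne']
    exact Real.log_le_log (mul_pos hl (hV ω)) (hW ω)
  · refine iSup_le fun bond => iSup_le fun stock => iSup_le fun h => ?_
    unfold logUtility
    split_ifs with hpos
    · rw [EReal.coe_le_coe_iff]
      have h1 := hg.expect_wealth_div_le hd hp0 hp1 hx h
      have h2 : expect p (fun ω : Path T => Real.log (wealth d lam bond stock T ω)) ≤
          expect p (fun ω : Path T => (Real.log (shadowWealth d c x k g T ω) + -1)
            + wealth d lam bond stock T ω / shadowWealth d c x k g T ω) := by
        refine expect_mono hp0 hp1 fun ω => ?_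
        have hV := hg.shadowWealth_pos hd hx T ω
        have h3 := Real.log_le_sub_one_of_pos (div_pos (hpos ω) hV)
        rw [Real.log_div (hpos ω).ne' hV.ne'] at h3
        linarith
      rw [expect_add, expect_add, expect_const] at h2
      linarith
    · exact bot_le

/-- The optimal growth rate is the growth rate in the shadow market. -/
theorem optimalGrowthRate_eq (hg : IsShadowPrice p d lam c k g) (hd : 0 < d) (hd1 : d < 1)
    (hl0 : 0 < lam) (hl1 : lam < 1) (hp0 : 0 ≤ p) (hp1 : p ≤ 1) {x : ℝ} (hx : 0 < x)
    {R : ℝ} {ψ : ℕ → ℝ} (hψ : IsPotential p d c k g R ψ) :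
    optimalGrowthRate p d lam x = (R : EReal) := by
  have hb := hg.optimalLogUtility_bounds hd hd1 hl0 hl1 hp0 hp1 hx
  -- The two bounds are finite, so the supremum is a real number and the limit can be taken in `ℝ`.
  have hlift : ∀ T : ℕ, ∃ u : ℝ, optimalLogUtility p d lam x T = (u : EReal) := by
    intro T
    refine ⟨(optimalLogUtility p d lam x T).toReal, (EReal.coe_toReal ?_ ?_).symm⟩
    · exact ((hb T).2.trans_lt (EReal.coe_lt_top _)).ne
    · exact ((EReal.bot_lt_coe _).trans_le (hb T).1).ne'
  choose u hu using hlift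
  -- The walk has finitely many states, so the correction `ψ` is bounded uniformly in the horizon.
  obtain ⟨M, hM⟩ : ∃ M : ℝ, ∀ j ≤ k, |ψ j| ≤ M := by
    refine ⟨∑ j ∈ Finset.range (k + 1), |ψ j|, fun j hj => ?_⟩
    exact Finset.single_le_sum (f := fun j => |ψ j|) (fun _ _ => abs_nonneg _)
      (Finset.mem_range.2 (by omega))
  have hE : ∀ T : ℕ, |expect p (fun ω : Path T => Real.log (shadowWealth d c x k g T ω)) - R * T|
      ≤ |Real.log x + ψ 0| + M := by
    intro T
    have h1 := hg.expect_log_shadowWealth hd hp0 hp1 hx hψ T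
    rw [expect_add] at h1
    have h2 : expect p (fun ω : Path T => ψ (walk k T ω)) ≤ expect p (fun _ : Path T => M) :=
      expect_mono hp0 hp1 fun ω => (abs_le.1 (hM _ (walk_le k T ω))).2
    have h3 : expect p (fun _ : Path T => -M) ≤ expect p (fun ω : Path T => ψ (walk k T ω)) :=
      expect_mono hp0 hp1 fun ω => (abs_le.1 (hM _ (walk_le k T ω))).1
    rw [expect_const] at h2 h3
    have h4 := neg_abs_le (Real.log x + ψ 0)
    have h5 := le_abs_self (Real.log x + ψ 0)
    rw [abs_le]
    constructor <;> linarith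
  set K : ℝ := |Real.log x + ψ 0| + M - Real.log (1 - lam) with hK
  have hlog : Real.log (1 - lam) < 0 := Real.log_neg (by linarith) (by linarith)
  have hu2 : ∀ T : ℕ, |u T - R * T| ≤ K := by
    intro T
    have h1 := hb T
    rw [hu T, EReal.coe_le_coe_iff, EReal.coe_le_coe_iff] at h1
    have h2 := abs_le.1 (hE T)
    rw [abs_le]
    constructor <;> linarith [h1.1, h1.2, h2.1, h2.2]
  have hlim : Tendsto (fun T : ℕ => u T / T) atTop (𝓝 R) := by
    rw [tendsto_iff_norm_sub_tendsto_zero]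
    refine squeeze_zero' (Eventually.of_forall fun _ => norm_nonneg _) ?_
      (tendsto_const_div_atTop_nhds_zero_nat K)
    filter_upwards [eventually_gt_atTop 0] with T hT
    have hT' : (0 : ℝ) < T := by exact_mod_cast hT
    rw [Real.norm_eq_abs, le_div_iff₀ hT', ← abs_of_pos hT', ← abs_mul, abs_of_pos hT']
    refine le_trans (le_of_eq ?_) (hu2 T)
    congr 1
    field_simp
  unfold optimalGrowthRate
  have he : (fun T : ℕ => optimalLogUtility p d lam x T / (T : EReal))
      = fun T : ℕ => ((u T / T : ℝ) : EReal) := by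
    funext T
    rw [hu T, EReal.coe_div]
    rfl
  rw [he]
  exact ((continuous_coe_real_ereal.tendsto R).comp hlim).limsup_eq

end IsShadowPrice

/-! ### Construction of the shadow price -/

/-- The geometric sum `1 + q + ⋯ + q ^ (i - 1)`. -/
def geomSum (q : ℝ) (i : ℕ) : ℝ := ∑ l ∈ Finset.range i, q ^ l

lemma geomSum_succ (q : ℝ) (i : ℕ) : geomSum q (i + 1) = 1 + q * geomSum q i := by
  unfold geomSum
  rw [Finset.sum_range_succ', Finset.mul_sum]
  simp [pow_succ, mul_comm, add_comm]

lemma geomSum_mono {q : ℝ} (hq : 0 ≤ q) : Monotone (geomSum q) := fun _ _ hij =>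
  Finset.sum_le_sum_of_subset_of_nonneg (Finset.range_mono hij) fun _ _ _ => pow_nonneg hq _

lemma geomSum_nonneg {q : ℝ} (hq : 0 ≤ q) (i : ℕ) : 0 ≤ geomSum q i :=
  Finset.sum_nonneg fun _ _ => pow_nonneg hq _

lemma one_sub_mul_geomSum (q : ℝ) (i : ℕ) : (1 - q) * geomSum q i = 1 - q ^ i := by
  unfold geomSum
  rw [mul_neg_geom_sum]

/-- The harmonic function of the biased random walk which equals `1 / (c + d)` in the first and
`1 / (c + 1)` in the second place. -/
def harmonicSeq (d q c : ℝ) (i : ℕ) : ℝ :=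
  (c + d)⁻¹ - (1 - d) / ((c + 1) * (c + d)) * geomSum q i

/-- The shadow price as a function of the state. -/
def priceFunction (d q c : ℝ) (j : ℕ) : ℝ := (harmonicSeq d q c (j + 1))⁻¹ - c

section

variable {p d q c lam : ℝ} {k : ℕ}

lemma harmonicSeq_zero (d q c : ℝ) : harmonicSeq d q c 0 = (c + d)⁻¹ := by
  simp [harmonicSeq, geomSum]

lemma harmonicSeq_one (hd : 0 < d) (hc : 0 < c) : harmonicSeq d q c 1 = (c + 1)⁻¹ := by
  have : c + d ≠ 0 := by positivity
  simp [harmonicSeq, geomSum]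
  field_simp
  ring

/-- Harmonicity for the biased walk means that consecutive increments have ratio `q`. -/
lemma harmonicSeq_harmonic (hq : p * q = 1 - p) (i : ℕ) :
    p * harmonicSeq d q c (i + 2) + (1 - p) * harmonicSeq d q c i = harmonicSeq d q c (i + 1) := by
  unfold harmonicSeq
  rw [show i + 2 = (i + 1) + 1 from rfl, geomSum_succ, geomSum_succ, ← hq]
  have h : p * (1 + q) = 1 := by linarith
  have e : p * ((c + d)⁻¹ - (1 - d) / ((c + 1) * (c + d)) * (1 + q * (1 + q * geomSum q i)))
      + p * q * ((c + d)⁻¹ - (1 - d) / ((c + 1) * (c + d)) * geomSum q i)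
      = (p * (1 + q)) * ((c + d)⁻¹ - (1 - d) / ((c + 1) * (c + d)) * (1 + q * geomSum q i)) := by
    ring
  rw [e, h, one_mul]

lemma harmonicSeq_antitone (hd : 0 < d) (hd1 : d < 1) (hc : 0 < c) (hq : 0 ≤ q) :
    Antitone (harmonicSeq d q c) := fun i j hij => by
  unfold harmonicSeq
  have h1 : 0 ≤ (1 - d) / ((c + 1) * (c + d)) :=
    div_nonneg (by linarith) (by positivity)
  have := mul_le_mul_of_nonneg_left (geomSum_mono hq hij) h1
  linarith

/-- The hypothesis `hS` encodes the reflection at the top, namely that `g k / d` continues the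
harmonic sequence, solved for the geometric sum. It makes the last values rational in `c`, `d`, `q`.
-/
lemma harmonicSeq_last (hd : 0 < d) (hd1 : d < 1) (hc : 0 < c) (hq : 0 < q)
    (hS : geomSum q (k + 1) * (c * (1 - d) ^ 2 * q) = (c + d) ^ 2 - q * d * (c + 1) ^ 2) :
    harmonicSeq d q c (k + 1)
      = (q * (c + 1) - (c + d)) / ((c + 1) * c * (1 - d) * q) := by
  have h1 : 1 - d ≠ 0 := by linarith
  have h2 : geomSum q (k + 1) = ((c + d) ^ 2 - q * d * (c + 1) ^ 2) / (c * (1 - d) ^ 2 * q) := by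
    rw [← hS]; field_simp
  have h3 : c + d ≠ 0 := by positivity
  unfold harmonicSeq
  rw [h2]
  field_simp
  ring

lemma harmonicSeq_after_last (hd : 0 < d) (hd1 : d < 1) (hc : 0 < c) (hq : 0 < q)
    (hS : geomSum q (k + 1) * (c * (1 - d) ^ 2 * q) = (c + d) ^ 2 - q * d * (c + 1) ^ 2) :
    harmonicSeq d q c (k + 2) = d * (q * (c + 1) - (c + d)) / (c * (1 - d) * (c + d)) := by
  have h1 : 1 - d ≠ 0 := by linarith
  have h2 : geomSum q (k + 1) = ((c + d) ^ 2 - q * d * (c + 1) ^ 2) / (c * (1 - d) ^ 2 * q) := by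
    rw [← hS]; field_simp
  have h3 : c + d ≠ 0 := by positivity
  unfold harmonicSeq
  rw [show k + 2 = (k + 1) + 1 from rfl, geomSum_succ, h2]
  field_simp
  ring

/-- The sequence decreases, so only its last value, which is explicit by `hS`, has to be positive.
-/
lemma harmonicSeq_pos (hd : 0 < d) (hd1 : d < 1) (hc : 0 < c) (hq : 0 < q)
    (hw : 0 < q * (c + 1) - (c + d))
    (hS : geomSum q (k + 1) * (c * (1 - d) ^ 2 * q) = (c + d) ^ 2 - q * d * (c + 1) ^ 2)
    {i : ℕ} (hi : i ≤ k + 2) : 0 < harmonicSeq d q c i := by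
  refine lt_of_lt_of_le ?_ (harmonicSeq_antitone hd hd1 hc hq.le hi)
  rw [harmonicSeq_after_last hd hd1 hc hq hS]
  have : 0 < 1 - d := by linarith
  positivity

/-- After clearing denominators the difference is a quadratic polynomial in `geomSum q i`. The
reflections at the two ends make it vanish at `i = 0` and `i = k + 1`, so it factors as in `key` and
is nonnegative in between. -/
lemma mul_inv_harmonicSeq_succ_le (hd : 0 < d) (hd1 : d < 1) (hc : 0 < c) (hq : 0 < q)
    (hw : 0 < q * (c + 1) - (c + d))
    (hS : geomSum q (k + 1) * (c * (1 - d) ^ 2 * q) = (c + d) ^ 2 - q * d * (c + 1) ^ 2)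
    {i : ℕ} (hi : i ≤ k + 1) :
    d * ((harmonicSeq d q c (i + 1))⁻¹ - c) ≤ (harmonicSeq d q c i)⁻¹ - c := by
  have h1 := harmonicSeq_pos hd hd1 hc hq hw hS (i := i) (by omega)
  have h2 := harmonicSeq_pos hd hd1 hc hq hw hS (i := i + 1) (by omega)
  have key : harmonicSeq d q c (i + 1) - d * harmonicSeq d q c i
      - c * (1 - d) * harmonicSeq d q c i * harmonicSeq d q c (i + 1)
      = c * (1 - d) ^ 3 * q / ((c + 1) * (c + d)) ^ 2
        * (geomSum q i * (geomSum q (k + 1) - geomSum q i)) := by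
    have h1 : 1 - d ≠ 0 := by linarith
    have h3 : c + d ≠ 0 := by positivity
    have h2 : geomSum q (k + 1) = ((c + d) ^ 2 - q * d * (c + 1) ^ 2) / (c * (1 - d) ^ 2 * q) := by
      rw [← hS]; field_simp
    unfold harmonicSeq
    rw [geomSum_succ, h2]
    field_simp
    ring
  have h3 : 0 ≤ harmonicSeq d q c (i + 1) - d * harmonicSeq d q c i
      - c * (1 - d) * harmonicSeq d q c i * harmonicSeq d q c (i + 1) := by
    rw [key]
    have h4 := geomSum_mono hq.le hi
    have h5 := geomSum_nonneg hq.le i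
    have h6 : 0 < 1 - d := by linarith
    exact mul_nonneg (by positivity) (mul_nonneg h5 (by linarith))
  have h4 : (harmonicSeq d q c i)⁻¹ - c - d * ((harmonicSeq d q c (i + 1))⁻¹ - c)
      = (harmonicSeq d q c (i + 1) - d * harmonicSeq d q c i
      - c * (1 - d) * harmonicSeq d q c i * harmonicSeq d q c (i + 1))
        / (harmonicSeq d q c i * harmonicSeq d q c (i + 1)) := by
    field_simp
    ring
  have h5 := div_nonneg h3 (mul_pos h1 h2).le
  rw [← h4] at h5
  linarith

lemma add_priceFunction (j : ℕ) : c + priceFunction d q c j = (harmonicSeq d q c (j + 1))⁻¹ := by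
  unfold priceFunction; ring

lemma priceFunction_last (hd : 0 < d) (hd1 : d < 1) (hc : 0 < c) (hq : 0 < q)
    (hw : 0 < q * (c + 1) - (c + d))
    (hS : geomSum q (k + 1) * (c * (1 - d) ^ 2 * q) = (c + d) ^ 2 - q * d * (c + 1) ^ 2) :
    priceFunction d q c k = c * (c + d - d * q * (c + 1)) / (q * (c + 1) - (c + d)) := by
  have h1 : 1 - d ≠ 0 := by linarith
  unfold priceFunction
  rw [harmonicSeq_last hd hd1 hc hq hS]
  have := hw.ne'
  field_simp
  ring

lemma add_priceFunction_last_div (hd : 0 < d) (hd1 : d < 1) (hc : 0 < c) (hq : 0 < q)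
    (hw : 0 < q * (c + 1) - (c + d))
    (hS : geomSum q (k + 1) * (c * (1 - d) ^ 2 * q) = (c + d) ^ 2 - q * d * (c + 1) ^ 2) :
    c + priceFunction d q c k * d⁻¹ = (harmonicSeq d q c (k + 2))⁻¹ := by
  have h1 : 1 - d ≠ 0 := by linarith
  rw [priceFunction_last hd hd1 hc hq hw hS, harmonicSeq_after_last hd hd1 hc hq hS]
  have := hw.ne'
  have h3 : c + d ≠ 0 := by positivity
  field_simp
  ring

lemma add_nextPrice_true (hd : 0 < d) (hd1 : d < 1) (hc : 0 < c) (hq : 0 < q)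
    (hw : 0 < q * (c + 1) - (c + d))
    (hS : geomSum q (k + 1) * (c * (1 - d) ^ 2 * q) = (c + d) ^ 2 - q * d * (c + 1) ^ 2)
    {j : ℕ} (hj : j ≤ k) :
    c + nextPrice d k (priceFunction d q c) j true = (harmonicSeq d q c (j + 2))⁻¹ := by
  rcases hj.lt_or_eq with h | h
  · simp [nextPrice, h, add_priceFunction]
  · subst h
    simp [nextPrice, add_priceFunction_last_div hd hd1 hc hq hw hS]

lemma add_nextPrice_false (j : ℕ) :
    c + nextPrice d k (priceFunction d q c) j false = (harmonicSeq d q c j)⁻¹ := by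
  rcases j with _ | j
  · simp [nextPrice, harmonicSeq_zero]
  · simp [nextPrice, add_priceFunction]

lemma priceFunction_zero (hd : 0 < d) (hc : 0 < c) : priceFunction d q c 0 = 1 := by
  simp [priceFunction, harmonicSeq_one hd hc]

/-- The function `priceFunction` describes a shadow price. -/
lemma isShadowPrice_priceFunction (hd : 0 < d) (hd1 : d < 1) (hc : 0 < c) (hq : 0 < q)
    (hpq : p * q = 1 - p) (hw : 0 < q * (c + 1) - (c + d))
    (hS : geomSum q (k + 1) * (c * (1 - d) ^ 2 * q) = (c + d) ^ 2 - q * d * (c + 1) ^ 2)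
    (hlam : c * (c + d - d * q * (c + 1)) / (q * (c + 1) - (c + d)) * d ^ k = 1 - lam) :
    IsShadowPrice p d lam c k (priceFunction d q c) := by
  have hlast : priceFunction d q c k * d ^ k = 1 - lam := by
    rw [priceFunction_last hd hd1 hc hq hw hS, hlam]
  -- The ratio of shadow price to ask price, `g j * d ^ j`, decreases in `j` from `1` to `1 - lam`;
  -- this gives both spread bounds.
  have hstep : ∀ j, j < k → priceFunction d q c (j + 1) * d ^ (j + 1)
      ≤ priceFunction d q c j * d ^ j := by
    intro j hj
    have h := mul_inv_harmonicSeq_succ_le hd hd1 hc hq hw hS (i := j + 1) (by omega)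
    have h2 := mul_le_mul_of_nonneg_right h (pow_pos hd j).le
    unfold priceFunction
    rw [pow_succ]
    linarith
  have hanti : ∀ i j, i ≤ j → j ≤ k → priceFunction d q c j * d ^ j
      ≤ priceFunction d q c i * d ^ i := by
    intro i j hij
    induction j, hij using Nat.le_induction with
    | base => exact fun _ => le_rfl
    | succ j _ ih => exact fun hj => (hstep j (by omega)).trans (ih (by omega))
  refine ⟨hc, fun j hj => ?_, priceFunction_zero hd hc, hlast, fun j hj => ?_, fun j hj => ?_,
    fun j hj => ?_⟩
  · have h1 := harmonicSeq_pos hd hd1 hc hq hw hS (i := j + 1) (by omega)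
    have h2 := harmonicSeq_antitone hd hd1 hc hq.le (show 1 ≤ j + 1 by omega)
    rw [harmonicSeq_one hd hc] at h2
    have h3 := inv_anti₀ h1 h2
    rw [inv_inv] at h3
    unfold priceFunction
    linarith
  · rw [← hlast]
    exact hanti j k hj le_rfl
  · have h := hanti 0 j (Nat.zero_le _) hj
    rwa [priceFunction_zero hd hc, pow_zero, one_mul] at h
  · rw [add_nextPrice_true hd hd1 hc hq hw hS hj, add_nextPrice_false, add_priceFunction,
      inv_inv, inv_inv, inv_inv, harmonicSeq_harmonic hpq]

/-- The increments of the solution of the Poisson equation. -/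
def potentialStep (p d q c R : ℝ) (i : ℕ) : ℝ :=
  R / p * geomSum q i - Real.log ((c + d) / (c + 1)) * q ^ i

/-- The solution of the Poisson equation for the logarithm of the shadow wealth. -/
def potential (p d q c R : ℝ) (j : ℕ) : ℝ :=
  ∑ i ∈ Finset.range j, potentialStep p d q c R (i + 1) - Real.log (c + priceFunction d q c j)

lemma isPotential_potential (hp : 0 < p) (hd : 0 < d) (hd1 : d < 1) (hc : 0 < c) (hq : 0 < q)
    (hpq : p * q = 1 - p) (hw : 0 < q * (c + 1) - (c + d))
    (hS : geomSum q (k + 1) * (c * (1 - d) ^ 2 * q) = (c + d) ^ 2 - q * d * (c + 1) ^ 2)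
    {R : ℝ} (hR : R * geomSum q (k + 1) = p * (Real.log ((c + d) / ((c + 1) * q * d))
      + Real.log ((c + d) / (c + 1)) * q ^ (k + 1))) :
    IsPotential p d c k (priceFunction d q c) R (potential p d q c R) := by
  intro j hj
  set Δ := potentialStep p d q c R with hΔ
  -- For `ψ j + log (c + g j)` the increments are `Δ (j + 1)` upwards and `-Δ j` downwards, also at
  -- the reflecting ends. There, `Δ 0` and `Δ (k + 1)` must be the logarithmic gains of the
  -- reflected steps.
  have hup : Real.log (c + nextPrice d k (priceFunction d q c) j true)
      + potential p d q c R (nextState k j true)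
      = ∑ i ∈ Finset.range (j + 1), Δ (i + 1) := by
    rcases hj.lt_or_eq with h | h
    · have h2 : min (j + 1) k = j + 1 := by omega
      simp only [nextPrice, nextState, h, if_true, h2, potential]
      ring
    · subst h
      have h2 : min (j + 1) j = j := by omega
      rw [add_nextPrice_true hd hd1 hc hq hw hS le_rfl, Finset.sum_range_succ]
      simp only [nextState, if_true, h2, potential, add_priceFunction]
      -- This boundary condition at the top is what determines `R`; `hR` is the equation solved for
      -- it.
      have h3 : Δ (j + 1) = Real.log ((c + d) / ((c + 1) * q * d)) := by
        rw [hΔ, potentialStep, div_mul_eq_mul_div, hR]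
        field_simp
        ring
      have h4 : (harmonicSeq d q c (j + 2))⁻¹
          = (c + d) / ((c + 1) * q * d) * (harmonicSeq d q c (j + 1))⁻¹ := by
        have h1 : 1 - d ≠ 0 := by linarith
        rw [harmonicSeq_last hd hd1 hc hq hS, harmonicSeq_after_last hd hd1 hc hq hS]
        have := hw.ne'
        field_simp
      have h5 := harmonicSeq_pos hd hd1 hc hq hw hS (i := j + 1) (by omega)
      rw [h4, h3, Real.log_mul (by positivity) (by positivity)]
      ring
  have hdn : Real.log (c + nextPrice d k (priceFunction d q c) j false)
      + potential p d q c R (nextState k j false)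
      = ∑ i ∈ Finset.range j, Δ (i + 1) - Δ j := by
    rcases j with _ | j
    · simp only [nextPrice, nextState, if_true, Bool.false_eq_true, if_false, potential,
        priceFunction_zero hd hc]
      have h3 : Δ 0 = - (Real.log (c + d) - Real.log (c + 1)) := by
        rw [← Real.log_div (by positivity) (by positivity), hΔ, potentialStep]
        simp [geomSum]
      rw [h3]
      simp
      ring
    · rw [Finset.sum_range_succ]
      simp only [nextPrice, nextState, Bool.false_eq_true, if_false, potential,
        Nat.add_eq_zero_iff, one_ne_zero, and_false, Nat.add_sub_cancel]
      ring
  have hΔj : p * Δ (j + 1) - (1 - p) * Δ j = R := by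
    rw [hΔ, potentialStep, potentialStep, geomSum_succ, ← hpq]
    field_simp
    ring
  rw [hup, hdn, Finset.sum_range_succ]
  have hmid : Real.log (c + priceFunction d q c j) + potential p d q c R j
      = ∑ i ∈ Finset.range j, Δ (i + 1) := by
    unfold potential; ring
  rw [hmid]
  linear_combination hΔj

/-- The optimal growth rate in terms of the ratio `c`. -/
theorem optimalGrowthRate_eq_of_ratio (hp : 0 < p) (hp1 : p < 1) (hd : 0 < d) (hd1 : d < 1)
    (hl0 : 0 < lam) (hl1 : lam < 1) (hc : 0 < c)
    (hpq : p * q = 1 - p) (hw : 0 < q * (c + 1) - (c + d))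
    (hS : geomSum q (k + 1) * (c * (1 - d) ^ 2 * q) = (c + d) ^ 2 - q * d * (c + 1) ^ 2)
    (hlam : c * (c + d - d * q * (c + 1)) / (q * (c + 1) - (c + d)) * d ^ k = 1 - lam)
    {R : ℝ} (hR : R * geomSum q (k + 1) = p * (Real.log ((c + d) / ((c + 1) * q * d))
      + Real.log ((c + d) / (c + 1)) * q ^ (k + 1))) {x : ℝ} (hx : 0 < x) :
    optimalGrowthRate p d lam x = (R : EReal) := by
  have hq : 0 < q := by
    by_contra h
    nlinarith
  exact (isShadowPrice_priceFunction hd hd1 hc hq hpq hw hS hlam).optimalGrowthRate_eq hd hd1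
    hl0 hl1 hp.le hp1.le hx (isPotential_potential hp hd hd1 hc hq hpq hw hS hR)

end

/-! ### The explicit functions in terms of the odds `q = (1 - p) / p` -/

/-- The parameters of the model: `0 < d < 1` and `d / (1 + d) < p < 1 / (1 + d)`, where the
probability `p` is expressed by the odds `q = (1 - p) / p`. -/
structure IsModel (p d q : ℝ) : Prop where
  d_pos : 0 < d
  d_lt_one : d < 1
  p_pos : 0 < p
  p_lt_one : p < 1
  odds_eq : q = (1 - p) / p
  d_lt : d < q
  mul_lt : d * q < 1

lemma isModel_odds {p d : ℝ} (hd0 : 0 < d) (hd1 : d < 1) (hp0 : d / (1 + d) < p)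
    (hp1 : p < 1 / (1 + d)) : IsModel p d ((1 - p) / p) := by
  have hd : 0 < 1 + d := by linarith
  have hp : 0 < p := lt_trans (by positivity) hp0
  rw [div_lt_iff₀ hd] at hp0
  rw [lt_div_iff₀ hd] at hp1
  refine ⟨hd0, hd1, hp, by nlinarith, rfl, ?_, ?_⟩
  · rw [lt_div_iff₀ hp]; linarith
  · rw [mul_div_assoc', div_lt_one hp]; linarith

/-- The first factor in `r(c)`. -/
def lowerFactor (d q c : ℝ) : ℝ := (c + d - d * q * (c + 1)) / ((1 - d) * q)

/-- The second factor in `r(c)`. -/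
def upperFactor (d q c : ℝ) : ℝ := (q * (c + 1) - (c + d)) / ((1 - d) * q)

/-- The growth rate `log ((c + d) / (c + 1))` at the lower boundary. -/
def lowerLog (d c : ℝ) : ℝ := Real.log ((c + d) / (c + 1))

/-! ### The affine factors of `r(c)` and the growth rate for integer `k` -/

namespace IsModel

variable {p d q c : ℝ}

lemma odds_pos (h : IsModel p d q) : 0 < q := h.d_pos.trans h.d_lt

lemma mul_odds (h : IsModel p d q) : p * q = 1 - p := by
  have := h.p_pos.ne'
  rw [h.odds_eq]; field_simp

lemma prob_eq (h : IsModel p d q) : p = 1 / (1 + q) := by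
  have h1 := h.mul_odds
  have h2 := h.odds_pos
  rw [eq_div_iff (by positivity)]; linarith

lemma odds_lt_one_iff (h : IsModel p d q) : q < 1 ↔ 1 / 2 < p := by
  have h1 := h.p_pos
  rw [h.odds_eq, div_lt_one h1]
  constructor <;> intro <;> linarith

lemma odds_eq_one_iff (h : IsModel p d q) : q = 1 ↔ p = 1 / 2 := by
  have h1 := h.p_pos.ne'
  rw [h.odds_eq, div_eq_one_iff_eq h1]
  constructor <;> intro <;> linarith

lemma cBar_eq (h : IsModel p d q) : cBar p d = (q - d) / (1 - d * q) := by
  have h1 := h.p_pos.ne'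
  have h2 : 1 - d * q ≠ 0 := by linarith [h.mul_lt]
  have h3 := h.mul_odds
  have h4 : p + p * d - d = p * (1 - d * q) := by linear_combination d * h3
  have h5 : 1 - p - p * d = p * (q - d) := by linear_combination -h3
  rw [cBar, h4, h5]
  field_simp

lemma cBar_pos (h : IsModel p d q) : 0 < cBar p d := by
  rw [h.cBar_eq]
  exact div_pos (by linarith [h.d_lt]) (by linarith [h.mul_lt])

lemma lowerFactor_eq (h : IsModel p d q) (c : ℝ) :
    (c * (p + p * d - d) + d * (2 * p - 1)) / ((1 - d) * (1 - p)) = lowerFactor d q c := by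
  have h1 := h.p_pos.ne'
  have h2 := h.odds_pos.ne'
  have h3 : 1 - d ≠ 0 := by linarith [h.d_lt_one]
  have h4 := h.mul_odds
  rw [lowerFactor, ← h4, div_eq_div_iff (by positivity) (by positivity)]
  linear_combination (c * d + d) * (1 - d) * q * h4

lemma upperFactor_eq (h : IsModel p d q) (c : ℝ) :
    (1 - p - p * d - c * (2 * p - 1)) / ((1 - d) * (1 - p)) = upperFactor d q c := by
  have h1 := h.p_pos.ne'
  have h2 := h.odds_pos.ne'
  have h3 : 1 - d ≠ 0 := by linarith [h.d_lt_one]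
  have h4 := h.mul_odds
  rw [upperFactor, ← h4, div_eq_div_iff (by positivity) (by positivity)]
  linear_combination -c * (1 - d) * q * h4

lemma rAux_eq (h : IsModel p d q) (c : ℝ) :
    rAux p d c = lowerFactor d q c * upperFactor d q c / c := by
  rw [← h.lowerFactor_eq, ← h.upperFactor_eq, rAux]
  rw [div_mul_div_comm, div_div]
  congr 1
  ring

lemma cBar_lt_of_mem (hc : c ∈ ratioInterval p d) : cBar p d < c := by
  unfold ratioInterval at hc
  split_ifs at hc
  · exact hc
  · exact hc.1

lemma pos_of_mem (h : IsModel p d q) (hc : c ∈ ratioInterval p d) : 0 < c :=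
  h.cBar_pos.trans (cBar_lt_of_mem hc)

/-- Centred at `c̄`, the two affine factors have values `1` and `c̄` and slopes with sum `1`. The
monotonicity and sign arguments for `F` and `G` are read off from this form. -/
lemma lowerFactor_sub (h : IsModel p d q) (c : ℝ) :
    lowerFactor d q c = 1 + (1 - d * q) / ((1 - d) * q) * (c - cBar p d) := by
  have h2 := h.odds_pos.ne'
  have h3 : 1 - d ≠ 0 := by linarith [h.d_lt_one]
  have h4 : 1 - d * q ≠ 0 := by linarith [h.mul_lt]
  rw [h.cBar_eq, lowerFactor]
  field_simp
  ring

lemma upperFactor_sub (h : IsModel p d q) (c : ℝ) :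
    upperFactor d q c = cBar p d + (q - 1) / ((1 - d) * q) * (c - cBar p d) := by
  have h2 := h.odds_pos.ne'
  have h3 : 1 - d ≠ 0 := by linarith [h.d_lt_one]
  have h4 : 1 - d * q ≠ 0 := by linarith [h.mul_lt]
  have h5 : 1 - q * d ≠ 0 := by rwa [mul_comm]
  rw [h.cBar_eq, upperFactor]
  field_simp
  ring

lemma lowerFactor_pos (h : IsModel p d q) (hc : cBar p d ≤ c) : 0 < lowerFactor d q c := by
  rw [h.lowerFactor_sub]
  have h1 : 0 < (1 - d * q) / ((1 - d) * q) :=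
    div_pos (by linarith [h.mul_lt]) (mul_pos (by linarith [h.d_lt_one]) h.odds_pos)
  have := mul_nonneg h1.le (sub_nonneg.2 hc)
  linarith

lemma upperFactor_pos (h : IsModel p d q) (hc : c ∈ ratioInterval p d) :
    0 < upperFactor d q c := by
  rw [← h.upperFactor_eq]
  have h1 := h.d_lt_one
  have h2 := h.p_lt_one
  refine div_pos ?_ (mul_pos (by linarith) (by linarith))
  have hc0 := h.pos_of_mem hc
  unfold ratioInterval at hc
  split_ifs at hc with hp
  · have h3 := h.d_lt
    have h4 := h.mul_odds
    nlinarith [mul_pos h.p_pos (sub_pos.2 h3)]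
  · have := (lt_div_iff₀ (by linarith)).1 hc.2
    linarith

lemma rAux_pos (h : IsModel p d q) (hc : c ∈ ratioInterval p d) : 0 < rAux p d c := by
  rw [h.rAux_eq]
  exact div_pos (mul_pos (h.lowerFactor_pos (cBar_lt_of_mem hc).le) (h.upperFactor_pos hc))
    (h.pos_of_mem hc)

lemma upperFactor_num_pos (h : IsModel p d q) (hc : c ∈ ratioInterval p d) :
    0 < q * (c + 1) - (c + d) := by
  have h1 := h.upperFactor_pos hc
  have h2 : 0 < (1 - d) * q := mul_pos (by linarith [h.d_lt_one]) h.odds_pos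
  exact (div_pos_iff_of_pos_right h2).1 h1

lemma log_odds_ne_zero (h : IsModel p d q) (hp : p ≠ 1 / 2) : Real.log q ≠ 0 :=
  Real.log_ne_zero_of_pos_of_ne_one h.odds_pos fun hq => hp (h.odds_eq_one_iff.1 hq)

/-- The growth rate is the optimal one when the number of steps is a natural number. -/
theorem optimalGrowthRate_eq_growthOfRatio (h : IsModel p d q) {lam : ℝ} (hl0 : 0 < lam)
    (hl1 : lam < 1) (hc : c ∈ ratioInterval p d) (hF : costOfRatio p d c = lam) {k : ℕ}
    (hk : netSteps p d c = k) {x : ℝ} (hx : 0 < x) :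
    optimalGrowthRate p d lam x = (growthOfRatio p d c : EReal) := by
  have hc0 := h.pos_of_mem hc
  have hq := h.odds_pos
  have hd := h.d_pos
  have hp := h.p_pos
  have hd1 : 0 < 1 - d := by linarith [h.d_lt_one]
  have hw := h.upperFactor_num_pos hc
  by_cases hp2 : p = 1 / 2
  · have hq1 := h.odds_eq_one_iff.2 hp2
    subst hq1
    have hk' : (c + d) * (c - 1) / (c * (1 - d)) = k := by
      simpa [netSteps, hp2] using hk
    have hS : geomSum 1 (k + 1) * (c * (1 - d) ^ 2 * 1)
        = (c + d) ^ 2 - 1 * d * (c + 1) ^ 2 := by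
      rw [div_eq_iff (by positivity)] at hk'
      simp only [geomSum, one_pow, Finset.sum_const, Finset.card_range, nsmul_eq_mul, mul_one]
      push_cast
      linear_combination (-(1 - d)) * hk'
    refine optimalGrowthRate_eq_of_ratio (q := 1) (k := k) hp h.p_lt_one hd h.d_lt_one hl0 hl1 hc0
      h.mul_odds hw hS ?_ ?_ hx
    · have h1 : 1 - c ^ 2 * d ^ (k : ℝ) = lam := by
        rw [← hk']
        simpa [costOfRatio, hp2] using hF
      rw [Real.rpow_natCast] at h1
      rw [← h1]
      have h2 : (1 : ℝ) * (c + 1) - (c + d) = 1 - d := by ring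
      have h3 := hd1.ne'
      rw [h2]
      field_simp
      ring
    · have hσ : geomSum 1 (k + 1) = (c ^ 2 - d) / (c * (1 - d)) := by
        rw [eq_div_iff (by positivity)]
        refine mul_left_cancel₀ hd1.ne' ?_
        linear_combination hS
      have hσ0 : 0 < geomSum 1 (k + 1) := by
        simp only [geomSum, one_pow, Finset.sum_const, Finset.card_range, nsmul_eq_mul, mul_one]
        positivity
      have hcd : c ^ 2 - d ≠ 0 := by
        intro h0
        rw [hσ, h0, zero_div] at hσ0
        exact lt_irrefl _ hσ0
      have hlog : Real.log ((c + d) / (Real.sqrt d * (c + 1)))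
          = Real.log ((c + d) / (c + 1)) - Real.log d / 2 := by
        have : 0 < Real.sqrt d := Real.sqrt_pos.2 hd
        rw [Real.log_div (by positivity) (by positivity),
          Real.log_mul (by positivity) (by positivity),
          Real.log_div (by positivity) (by positivity), Real.log_sqrt hd.le]
        ring
      have hlog2 : Real.log ((c + d) / ((c + 1) * 1 * d))
          = Real.log ((c + d) / (c + 1)) - Real.log d := by
        rw [mul_one, ← div_div, Real.log_div (by positivity) hd.ne']
      rw [hσ, growthOfRatio, if_pos hp2, hlog, hlog2, hp2, one_pow]
      have := hd1.ne'
      field_simp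
      ring
  · have hlq := h.log_odds_ne_zero hp2
    have hr0 := h.rAux_pos hc
    have hq1 : q ≠ 1 := fun hq => hp2 (h.odds_eq_one_iff.1 hq)
    have hk' : Real.log (rAux p d c) = k * Real.log q := by
      rw [netSteps, if_neg hp2, ← h.odds_eq, div_eq_iff hlq] at hk
      exact hk
    -- Integrality of `k` turns the real power into an honest one, which is where the lattice walk
    -- meets the closed formulas.
    have hr : rAux p d c = q ^ k := by
      rw [← Real.exp_log hr0, hk', mul_comm, Real.exp_mul, Real.exp_log hq, Real.rpow_natCast]
    have hA := h.lowerFactor_pos (cBar_lt_of_mem hc).le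
    have hB := h.upperFactor_pos hc
    have hqk : q ^ k * (c * (1 - d) ^ 2 * q ^ 2)
        = (c + d - d * q * (c + 1)) * (q * (c + 1) - (c + d)) := by
      rw [← hr, h.rAux_eq, lowerFactor, upperFactor]
      field_simp
    have hS : geomSum q (k + 1) * (c * (1 - d) ^ 2 * q)
        = (c + d) ^ 2 - q * d * (c + 1) ^ 2 := by
      have h1 := one_sub_mul_geomSum q (k + 1)
      have h2 : 1 - q ≠ 0 := sub_ne_zero.2 hq1.symm
      refine mul_left_cancel₀ h2 ?_
      rw [pow_succ] at h1
      linear_combination (c * (1 - d) ^ 2 * q) * h1 - hqk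
    refine optimalGrowthRate_eq_of_ratio (q := q) (k := k) hp h.p_lt_one hd h.d_lt_one hl0 hl1 hc0
      h.mul_odds hw hS ?_ ?_ hx
    · rw [costOfRatio, if_neg hp2, h.lowerFactor_eq, ← h.odds_eq] at hF
      -- The exponent `b` satisfies `q ^ b = d`, hence `r ^ (b - 1) = (d / q) ^ k`.
      have hb : rAux p d c ^ (Real.log d / Real.log q - 1) = d ^ k / q ^ k := by
        rw [Real.rpow_sub_one hr0.ne', Real.rpow_def_of_pos hr0, hk',
          show (k : ℝ) * Real.log q * (Real.log d / Real.log q) = Real.log d * k by field_simp,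
          Real.exp_mul, Real.exp_log hd, Real.rpow_natCast, hr]
      rw [hb] at hF
      have hqk2 : q ^ k = (c + d - d * q * (c + 1)) * (q * (c + 1) - (c + d))
          / (c * (1 - d) ^ 2 * q ^ 2) := by
        rw [eq_div_iff (by positivity), hqk]
      have hy : 0 < c + d - d * q * (c + 1) := by
        rw [lowerFactor] at hA
        exact (div_pos_iff_of_pos_right (by positivity)).1 hA
      rw [← hF, hqk2, lowerFactor]
      have := hw.ne'
      field_simp
      ring
    · have hσ : geomSum q (k + 1) = (1 - q ^ (k + 1)) / (1 - q) := by
        rw [← one_sub_mul_geomSum, mul_div_cancel_left₀]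
        exact sub_ne_zero.2 hq1.symm
      have hinv : p / (1 - p) = q⁻¹ := by rw [h.odds_eq, inv_div]
      have hlog : (c + d) * p / ((c + 1) * (1 - p) * d) = (c + d) / ((c + 1) * q * d) := by
        rw [← h.mul_odds]
        field_simp
      have hpow : (q⁻¹ : ℝ) ^ ((k : ℝ) + 1) = (q ^ (k + 1))⁻¹ := by
        have : ((k : ℝ) + 1) = ((k + 1 : ℕ) : ℝ) := by push_cast; ring
        rw [this, Real.rpow_natCast, inv_pow]
      have hne : 1 - q ^ (k + 1) ≠ 0 := by
        rw [← one_sub_mul_geomSum]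
        refine mul_ne_zero (sub_ne_zero.2 hq1.symm) ?_
        rw [geomSum_succ]
        have := geomSum_nonneg hq.le k
        positivity
      rw [growthOfRatio, if_neg hp2, hk, hinv, hpow, Real.rpow_natCast, inv_pow, hlog, hσ,
        ← h.mul_odds]
      have h2 : 1 - q ≠ 0 := sub_ne_zero.2 hq1.symm
      have h3 : q ^ (k + 1) - 1 ≠ 0 := fun h0 => hne (by linarith)
      have h4 : 1 - (q ^ (k + 1))⁻¹ ≠ 0 := by
        intro h0
        apply hne
        have h5 : (q ^ (k + 1))⁻¹ = 1 := by linarith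
        rw [inv_eq_one.1 h5, sub_self]
      have h5 : 1 - 2 * p = p * (q - 1) := by linear_combination -h.mul_odds
      rw [h5]
      have h6 : q ^ (k + 1) ≠ 0 := by positivity
      have h7 : (1 - (q ^ (k + 1))⁻¹) = (q ^ (k + 1) - 1) / q ^ (k + 1) := by field_simp
      rw [h7, pow_succ]
      rw [pow_succ] at hne h3
      have h8 : q ^ k * q - 1 ≠ 0 := h3
      generalize Real.log ((c + d) / (c + 1)) = l0
      generalize Real.log ((c + d) / ((c + 1) * q * d)) = l1
      have h9 : q ^ k ≠ 0 := by positivity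
      generalize q ^ k = X at *
      rw [show (1 - X * q) / (1 - q) = (X * q - 1) / (q - 1) by
        rw [← neg_sub, ← neg_sub q 1, neg_div_neg_eq]]
      have h10 : q - 1 ≠ 0 := sub_ne_zero.2 hq1
      have h11 : q * X - 1 ≠ 0 := by rwa [mul_comm]
      field_simp
      ring

end IsModel

/-! ### First-order expansion along a parametrized curve -/

/-- The first two Taylor coefficients vanish, so the power series remainder of order two is the
function itself. -/
lemma isBigO_sq_of_hasDerivAt_zero {H : ℝ → ℝ} {x₀ : ℝ} (hH : AnalyticAt ℝ H x₀)
    (h0 : H x₀ = 0) (h1 : HasDerivAt H 0 x₀) :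
    (fun y => H (x₀ + y)) =O[𝓝 0] fun y => y ^ 2 := by
  obtain ⟨s, hs⟩ := hH
  have hO := hs.isBigO_sub_partialSum_pow 2
  have hs1 : s 1 (fun _ => 1) = 0 := hs.hasDerivAt.unique h1
  have hsum : ∀ y : ℝ, s.partialSum 2 y = 0 := by
    intro y
    have e1 : s 1 (fun _ => y) = y * s 1 (fun _ => 1) := by
      simp
    have e0 : s 0 (fun _ => y) = 0 := by
      rw [hs.coeff_zero, h0]
    rw [FormalMultilinearSeries.partialSum, Finset.sum_range_succ, Finset.sum_range_one, e0, e1,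
      hs1, mul_zero, add_zero]
  simp only [hsum, sub_zero] at hO
  refine hO.trans (Asymptotics.isBigO_of_le _ fun y => ?_)
  simp

/-- If `G` and `F` are analytic at `x₀`, then `G` is an affine function of `F` up to an error which
is quadratic in `F`. -/
lemma exists_abs_sub_le_sq {F G : ℝ → ℝ} {x₀ R₀ R₁ F₁ M : ℝ} {I : Set ℝ}
    (hI : ∀ x ∈ I, x₀ < x) (hF0 : F x₀ = 0) (hG0 : G x₀ = R₀) (hF₁ : 0 < F₁)
    (hF : HasDerivAt F F₁ x₀) (hG : HasDerivAt G (R₁ * F₁) x₀)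
    (hFa : AnalyticAt ℝ F x₀) (hGa : AnalyticAt ℝ G x₀)
    (hmono : ∀ x ∈ I, StrictMonoOn F (Icc x₀ x)) (hM : ∀ x ∈ I, |G x| ≤ M) :
    ∃ C : ℝ, ∀ x ∈ I, F x < 1 → |G x - (R₀ + R₁ * F x)| ≤ C * F x ^ 2 := by
  -- Working with `H` as a function of the parameter avoids inverting `F`: `H` vanishes to second
  -- order at `x₀`, while `F` grows at least linearly there.
  set H : ℝ → ℝ := fun x => G x - (R₀ + R₁ * F x) with hH
  have hHa : AnalyticAt ℝ H x₀ := hGa.sub (analyticAt_const.add (analyticAt_const.mul hFa))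
  have hH0 : H x₀ = 0 := by simp [hH, hF0, hG0]
  have hH1 : HasDerivAt H 0 x₀ := by
    exact (hG.sub ((hF.const_mul R₁).const_add R₀)).congr_deriv (sub_self _)
  obtain ⟨C₁, hC₁⟩ := (isBigO_sq_of_hasDerivAt_zero hHa hH0 hH1).bound
  have hlow : ∀ᶠ y in 𝓝 (0 : ℝ), 0 < y → F₁ / 2 * y ≤ F (x₀ + y) := by
    have ho := (hasDerivAt_iff_isLittleO_nhds_zero.1 hF).def (half_pos hF₁)
    filter_upwards [ho] with y hy hy0
    rw [hF0, Real.norm_eq_abs, Real.norm_eq_abs, abs_of_pos hy0, smul_eq_mul] at hy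
    linarith [(abs_le.1 hy).1]
  obtain ⟨ε, hε, hball⟩ := Metric.eventually_nhds_iff.1 (hC₁.and hlow)
  have near : ∀ x ∈ I, x < x₀ + ε → |H x| ≤ |C₁| * (2 / F₁) ^ 2 * F x ^ 2 := by
    intro x hx hlt
    have hx0 := hI x hx
    have hb := hball (y := x - x₀) (by
      rw [Real.dist_eq, sub_zero, abs_of_pos (by linarith)]; linarith)
    rw [add_sub_cancel] at hb
    have h1 := hb.2 (by linarith)
    have h2 := hb.1
    rw [Real.norm_eq_abs, Real.norm_eq_abs, abs_of_nonneg (sq_nonneg (x - x₀))] at h2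
    have h3 : x - x₀ ≤ 2 / F₁ * F x := by
      rw [div_mul_eq_mul_div, le_div_iff₀ hF₁]; linarith
    have h4 : (x - x₀) ^ 2 ≤ (2 / F₁ * F x) ^ 2 :=
      pow_le_pow_left₀ (by linarith) h3 2
    calc |H x| ≤ C₁ * (x - x₀) ^ 2 := h2
      _ ≤ |C₁| * (x - x₀) ^ 2 := mul_le_mul_of_nonneg_right (le_abs_self _) (sq_nonneg _)
      _ ≤ |C₁| * (2 / F₁ * F x) ^ 2 := mul_le_mul_of_nonneg_left h4 (abs_nonneg _)
      _ = |C₁| * (2 / F₁) ^ 2 * F x ^ 2 := by ring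
  -- The set `I` may end before `x₀ + ε / 2`; then the local bound covers it. Otherwise monotonicity
  -- gives the lower bound `δ` for `F` on the far part of `I`, where boundedness of `H` suffices.
  by_cases hne : ∃ z ∈ I, x₀ + ε / 2 ≤ z
  · obtain ⟨z, hz, hzε⟩ := hne
    set δ := F (x₀ + ε / 2) with hδ
    have hδ0 : 0 < δ := by
      rw [← hF0]
      exact hmono z hz ⟨le_rfl, (hI z hz).le⟩ ⟨by linarith, hzε⟩ (by linarith)
    refine ⟨max (|C₁| * (2 / F₁) ^ 2) ((M + |R₀| + |R₁|) / δ ^ 2), fun x hx hx1 => ?_⟩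
    rcases lt_or_ge x (x₀ + ε / 2) with hlt | hge
    · exact (near x hx (by linarith)).trans
        (mul_le_mul_of_nonneg_right (le_max_left _ _) (sq_nonneg _))
    · have h1 : δ ≤ F x :=
        (hmono x hx).monotoneOn ⟨by linarith, hge⟩ ⟨(hI x hx).le, le_rfl⟩ hge
      have h2 : |H x| ≤ M + |R₀| + |R₁| := by
        have h3 : |R₁ * F x| ≤ |R₁| := by
          rw [abs_mul]
          refine mul_le_of_le_one_right (abs_nonneg _) ?_
          rw [abs_of_pos (by linarith)]
          exact hx1.le
        calc |H x| ≤ |G x| + |R₀ + R₁ * F x| := abs_sub _ _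
          _ ≤ |G x| + (|R₀| + |R₁ * F x|) := by gcongr; exact abs_add_le _ _
          _ ≤ _ := by linarith [hM x hx]
      have h3 : 0 ≤ M + |R₀| + |R₁| := (abs_nonneg _).trans h2
      calc |H x| ≤ (M + |R₀| + |R₁|) / δ ^ 2 * δ ^ 2 := by
            rw [div_mul_cancel₀ _ (by positivity)]; exact h2
        _ ≤ (M + |R₀| + |R₁|) / δ ^ 2 * F x ^ 2 := by gcongr
        _ ≤ _ := mul_le_mul_of_nonneg_right (le_max_right _ _) (sq_nonneg _)
  · push Not at hne
    exact ⟨_, fun x hx _ => near x hx (by linarith [hne x hx])⟩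

/-! ### The inequality `(1 + d) η > 1` -/

/-- This is `t < sinh t` at `t = -log x`. -/
lemma neg_two_mul_log_lt {x : ℝ} (hx0 : 0 < x) (hx1 : x < 1) : -(2 * Real.log x) < x⁻¹ - x := by
  have h := Real.self_lt_sinh_iff.2 (neg_pos.2 (Real.log_neg hx0 hx1))
  rw [Real.sinh_eq, neg_neg, Real.exp_neg, Real.exp_log hx0] at h
  linarith

lemma strictMonoOn_log_mul_div :
    StrictMonoOn (fun x : ℝ => Real.log x * ((1 + x) / (1 - x))) (Ioo 0 1) := by
  have hder : ∀ x ∈ Ioo (0 : ℝ) 1, HasDerivAt (fun x : ℝ => Real.log x * ((1 + x) / (1 - x)))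
      ((x⁻¹ - x + 2 * Real.log x) / (1 - x) ^ 2) x := by
    intro x hx
    have h0 : x ≠ 0 := hx.1.ne'
    have h1 : 1 - x ≠ 0 := by linarith [hx.2]
    have h := (Real.hasDerivAt_log h0).mul
      (((hasDerivAt_id x).const_add 1).div ((hasDerivAt_id x).const_sub 1) h1)
    refine h.congr_deriv ?_
    simp only [id, Pi.div_apply]
    field_simp
    ring
  refine strictMonoOn_of_deriv_pos (convex_Ioo 0 1)
    (fun x hx => (hder x hx).continuousAt.continuousWithinAt) fun x hx => ?_
  rw [interior_Ioo] at hx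
  rw [(hder x hx).deriv]
  have h1 : 0 < 1 - x := by linarith [hx.2]
  have h2 := neg_two_mul_log_lt hx.1 hx.2
  exact div_pos (by linarith) (by positivity)

/-- The bound `-2` is the limit of `log x * (1 + x) / (1 - x)` at `x = 1`, so this is the case `q =
1` of the comparison between `d` and the odds. -/
lemma log_mul_div_lt_neg_two {d : ℝ} (hd0 : 0 < d) (hd1 : d < 1) :
    Real.log d * (1 + d) < -(2 * (1 - d)) := by
  have h1 : 1 < d⁻¹ := (one_lt_inv₀ hd0).2 hd1
  have h := Real.lt_log_one_add_of_pos (x := d⁻¹ - 1) (by linarith)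
  rw [add_sub_cancel, Real.log_inv] at h
  have h2 : 2 * (d⁻¹ - 1) / (d⁻¹ - 1 + 2) = 2 * (1 - d) / (1 + d) := by
    rw [div_eq_div_iff (by linarith) (by linarith)]
    field_simp
    ring
  rw [h2, div_lt_iff₀ (by linarith)] at h
  linarith

namespace IsModel

variable {p d q : ℝ}

lemma eta_eq (h : IsModel p d q) (hp : p ≠ 1 / 2) :
    eta p d = Real.log d / Real.log q * ((1 - q) / ((1 + q) * (1 - d))) := by
  have h1 := h.odds_pos
  have h2 : 1 - d ≠ 0 := by linarith [h.d_lt_one]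
  have h3 := h.log_odds_ne_zero hp
  have h4 : 2 * p - 1 = (1 - q) / (1 + q) := by
    rw [h.prob_eq]; field_simp; ring
  rw [eta, if_neg hp, ← h.odds_eq, h4]
  field_simp

/-- The claim compares `log x * (1 + x) / (1 - x)` at `d` and at the odds. This function is
invariant under `x ↦ 1 / x`, so for `q > 1` the odds are replaced by `1 / q`, and `d < 1 / q` is `d
* q < 1`. -/
lemma one_lt_mul_eta (h : IsModel p d q) : 1 < (1 + d) * eta p d := by
  have hd := h.d_pos
  have hd1 : 0 < 1 - d := by linarith [h.d_lt_one]
  have hq := h.odds_pos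
  by_cases hp : p = 1 / 2
  · rw [eta, if_pos hp, mul_div_assoc', lt_div_iff_of_neg (by linarith)]
    linarith [log_mul_div_lt_neg_two hd h.d_lt_one]
  · have hlq := h.log_odds_ne_zero hp
    rw [h.eta_eq hp]
    have key : Real.log d * ((1 + d) / (1 - d)) * (1 - q) * (Real.log q)⁻¹ > 1 + q := by
      rcases lt_or_gt_of_ne (fun hq1 => hp (h.odds_eq_one_iff.1 hq1) : q ≠ 1) with hq1 | hq1
      · have h1 := strictMonoOn_log_mul_div ⟨hd, h.d_lt_one⟩ ⟨hq, hq1⟩ h.d_lt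
        have h2 : (Real.log q)⁻¹ < 0 := inv_lt_zero.2 (Real.log_neg hq hq1)
        have h3 : 0 < 1 - q := by linarith
        have h4 := mul_lt_mul_of_neg_right (mul_lt_mul_of_pos_right h1 h3) h2
        refine lt_of_eq_of_lt ?_ h4
        field_simp
      · have h0 : q⁻¹ < 1 := inv_lt_one_of_one_lt₀ hq1
        have hdq : d < q⁻¹ := by
          rw [lt_inv_comm₀ hd hq, ← one_div, lt_div_iff₀ hd]
          linarith [h.mul_lt]
        have h1 := strictMonoOn_log_mul_div ⟨hd, h.d_lt_one⟩ ⟨inv_pos.2 hq, h0⟩ hdq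
        simp only [Real.log_inv] at h1
        have h2 : 0 < (Real.log q)⁻¹ := inv_pos.2 (Real.log_pos hq1)
        have h3 : 1 - q < 0 := by linarith
        have h4 := mul_lt_mul_of_pos_right (mul_lt_mul_of_neg_right h1 h3) h2
        refine lt_of_eq_of_lt ?_ h4
        have h5 : 1 - q⁻¹ = -(1 - q) / q := by field_simp; ring
        rw [h5]
        have := h3.ne
        field_simp
        ring
    have h3 := (one_lt_div (show (0 : ℝ) < 1 + q by linarith)).2 key
    refine lt_of_lt_of_eq h3 ?_
    field_simp

/-- The argument `(1 + d) ^ 2 p (1 - p) / d` of the logarithm in the first-order coefficient. -/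
lemma log_arg_sub_one (h : IsModel p d q) :
    (1 + d) ^ 2 * (1 - p) * p / d - 1
      = (p + p * d - d) * (1 - p - p * d) / d := by
  have := h.d_pos.ne'
  field_simp
  ring

/-- With `z` the argument of the logarithm, the numerator is `d * (z - 1 - z * log z)`. It is
negative since `z > 1`, and the denominator is positive by `one_lt_mul_eta`. -/
lemma growthCoeffOne_neg (h : IsModel p d q) : growthCoeffOne p d < 0 := by
  have hd := h.d_pos
  have hp := h.p_pos
  have hd1 := h.d_lt_one
  have hpq := h.mul_odds
  have h1 : 0 < p + p * d - d := by nlinarith [mul_pos hp (sub_pos.2 h.mul_lt)]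
  have h2 : 0 < 1 - p - p * d := by nlinarith [mul_pos hp (sub_pos.2 h.d_lt)]
  have hz := h.log_arg_sub_one
  set z := (1 + d) ^ 2 * (1 - p) * p / d with hzdef
  have hz1 : 1 < z := by
    have : 0 < (p + p * d - d) * (1 - p - p * d) / d := by positivity
    linarith
  have hlog : 1 - z⁻¹ < Real.log z := by
    have h3 := Real.log_lt_sub_one_of_pos (inv_pos.2 (by linarith : 0 < z))
      (inv_lt_one_of_one_lt₀ hz1).ne
    rw [Real.log_inv] at h3
    linarith
  have hzlog : z - 1 < z * Real.log z := by
    have h3 := mul_lt_mul_of_pos_left hlog (by linarith : 0 < z)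
    rw [mul_sub, mul_inv_cancel₀ (by linarith : z ≠ 0), mul_one] at h3
    exact h3
  have e1 : (p + p * d - d) * (1 - p - p * d) = d * (z - 1) := by
    rw [hz]; field_simp
  have e2 : (1 + d) ^ 2 * (1 - p) * p = d * z := by
    rw [hzdef]; field_simp
  have h3 := h.one_lt_mul_eta
  rw [growthCoeffOne, e1, e2, ← e2, ← hzdef, e2]
  refine div_neg_of_neg_of_pos ?_ (mul_pos (by nlinarith) (by linarith))
  nlinarith [mul_lt_mul_of_pos_left hzlog hd]

end IsModel

/-! ### The functions `F` and `G` for `p ≠ 1 / 2` -/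

/-- The logarithm of `1 - F`. -/
def logCost (d q c : ℝ) : ℝ :=
  (Real.log d / Real.log q + 1) * Real.log (lowerFactor d q c)
    + (Real.log d / Real.log q - 1) * (Real.log (upperFactor d q c) - Real.log c)

/-- The slope of `lowerFactor`. -/
def lowerSlope (d q : ℝ) : ℝ := (1 - d * q) / ((1 - d) * q)

/-- The function `G` without powers. -/
def growthAux (p d q c : ℝ) : ℝ :=
  p * (q - 1) * (q * (lowerFactor d q c * upperFactor d q c / c) * lowerLog d c + lowerLog d c
    - Real.log (q * d)) / (q * (lowerFactor d q c * upperFactor d q c / c) - 1)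

lemma hasDerivAt_lowerFactor (d q c : ℝ) :
    HasDerivAt (lowerFactor d q) (lowerSlope d q) c := by
  have h := ((((hasDerivAt_id c).add_const d).sub
    (((hasDerivAt_id c).add_const 1).const_mul (d * q))).div_const ((1 - d) * q))
  rw [mul_one] at h
  exact h

lemma hasDerivAt_lowerLog {d c : ℝ} (hd : 0 < d) (hc : 0 < c) :
    HasDerivAt (lowerLog d) ((c + d)⁻¹ - (c + 1)⁻¹) c := by
  have h1 : c + d ≠ 0 := by positivity
  have h2 : c + 1 ≠ 0 := by positivity
  have h := (((hasDerivAt_id c).add_const d).div ((hasDerivAt_id c).add_const 1) h2).log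
    (div_ne_zero h1 h2)
  refine h.congr_deriv ?_
  simp only [id, Pi.div_apply]
  field_simp

lemma analyticAt_lowerLog {d c : ℝ} (hd : 0 < d) (hc : 0 < c) : AnalyticAt ℝ (lowerLog d) c := by
  have h1 : 0 < (c + d) / (c + 1) := by positivity
  have h2 : c + 1 ≠ 0 := by positivity
  unfold lowerLog
  fun_prop (disch := assumption)

lemma analyticAt_lowerFactor (d q c : ℝ) : AnalyticAt ℝ (lowerFactor d q) c := by
  unfold lowerFactor; fun_prop

lemma analyticAt_upperFactor (d q c : ℝ) : AnalyticAt ℝ (upperFactor d q) c := by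
  unfold upperFactor; fun_prop

lemma abs_lowerLog_le {d c : ℝ} (hd : 0 < d) (hd1 : d < 1) (hc : 0 ≤ c) :
    |lowerLog d c| ≤ -Real.log d := by
  have h1 : (c + d) / (c + 1) ≤ 1 := by
    rw [div_le_one (by positivity)]; linarith
  have h2 : d ≤ (c + d) / (c + 1) := by
    rw [le_div_iff₀ (by positivity)]; nlinarith
  have h3 := Real.log_le_log hd h2
  have h4 := Real.log_nonpos (hd.le.trans h2) h1
  rw [lowerLog, abs_of_nonpos h4]
  linarith

namespace IsModel

variable {p d q c : ℝ}

lemma lowerSlope_pos (h : IsModel p d q) : 0 < lowerSlope d q :=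
  div_pos (by linarith [h.mul_lt]) (mul_pos (by linarith [h.d_lt_one]) h.odds_pos)

lemma one_sub_lowerSlope (h : IsModel p d q) :
    1 - lowerSlope d q = (q - 1) / ((1 - d) * q) := by
  have h2 := h.odds_pos.ne'
  have h3 : 1 - d ≠ 0 := by linarith [h.d_lt_one]
  rw [lowerSlope]
  field_simp
  ring

lemma hasDerivAt_upperFactor (h : IsModel p d q) (c : ℝ) :
    HasDerivAt (upperFactor d q) (1 - lowerSlope d q) c := by
  have h1 := ((((hasDerivAt_id c).add_const 1).const_mul q).sub
    ((hasDerivAt_id c).add_const d)).div_const ((1 - d) * q)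
  rw [mul_one, ← h.one_sub_lowerSlope] at h1
  exact h1

lemma lowerFactor_cBar (h : IsModel p d q) : lowerFactor d q (cBar p d) = 1 := by
  rw [h.lowerFactor_sub, sub_self, mul_zero, add_zero]

lemma upperFactor_cBar (h : IsModel p d q) : upperFactor d q (cBar p d) = cBar p d := by
  rw [h.upperFactor_sub, sub_self, mul_zero, add_zero]

lemma upperFactor_pos_of_le (h : IsModel p d q) {e : ℝ} (he : e ∈ ratioInterval p d)
    (hc : cBar p d ≤ c) (hce : c ≤ e) : 0 < upperFactor d q c := by
  have h1 := h.upperFactor_pos he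
  have h2 := h.cBar_pos
  rw [h.upperFactor_sub] at h1 ⊢
  rcases le_total 0 ((q - 1) / ((1 - d) * q)) with hs | hs
  · have := mul_nonneg hs (sub_nonneg.2 hc)
    linarith
  · have := mul_le_mul_of_nonpos_left (sub_le_sub_right hce (cBar p d)) hs
    linarith

lemma costOfRatio_eq (h : IsModel p d q) (hp : p ≠ 1 / 2) (hc : 0 < c)
    (hA : 0 < lowerFactor d q c) (hB : 0 < upperFactor d q c) :
    costOfRatio p d c = 1 - Real.exp (logCost d q c) := by
  rw [costOfRatio, if_neg hp, h.lowerFactor_eq, h.rAux_eq, ← h.odds_eq,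
    Real.rpow_def_of_pos (by positivity), Real.log_div (by positivity) hc.ne',
    Real.log_mul hA.ne' hB.ne', logCost]
  congr 1
  nth_rewrite 1 [← Real.exp_log hA]
  rw [← Real.exp_nat_mul, ← Real.exp_add]
  congr 1
  push_cast
  ring

/-- The derivative collapses because the constant term of the affine function `upperFactor` is
`lowerSlope * c̄`. -/
lemma hasDerivAt_logCost (h : IsModel p d q) (hc : 0 < c)
    (hA : 0 < lowerFactor d q c) (hB : 0 < upperFactor d q c) :
    HasDerivAt (logCost d q)
      (lowerSlope d q * ((Real.log d / Real.log q + 1) / lowerFactor d q c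
        - (Real.log d / Real.log q - 1) * cBar p d / (c * upperFactor d q c))) c := by
  have h1 := (((hasDerivAt_lowerFactor d q c).log hA.ne').const_mul
    (Real.log d / Real.log q + 1)).add ((((h.hasDerivAt_upperFactor c).log hB.ne').sub
      (Real.hasDerivAt_log hc.ne')).const_mul (Real.log d / Real.log q - 1))
  refine h1.congr_deriv ?_
  have e : upperFactor d q c - (1 - lowerSlope d q) * c = lowerSlope d q * cBar p d := by
    rw [h.upperFactor_sub, ← h.one_sub_lowerSlope]
    ring
  have e2 : (1 - lowerSlope d q) / upperFactor d q c - c⁻¹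
      = -(lowerSlope d q * cBar p d) / (c * upperFactor d q c) := by
    rw [← e]
    field_simp
    ring
  rw [e2]
  ring

/-- The inequality `(b + 1) c̄ < b - 1`, which is equivalent to `(1 + d) η > 1`. -/
lemma add_one_mul_cBar_lt (h : IsModel p d q) (hp : p ≠ 1 / 2) :
    (Real.log d / Real.log q + 1) * cBar p d < Real.log d / Real.log q - 1 := by
  have h1 := h.one_lt_mul_eta
  have hd1 : 0 < 1 - d := by linarith [h.d_lt_one]
  have hq := h.odds_pos
  have h2 : 0 < 1 - d * q := by linarith [h.mul_lt]
  rw [h.eta_eq hp] at h1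
  set b := Real.log d / Real.log q
  have h3 : (1 + d) * (b * ((1 - q) / ((1 + q) * (1 - d))))
      = (1 + d) * b * (1 - q) / ((1 + q) * (1 - d)) := by ring
  rw [h3, one_lt_div (by positivity)] at h1
  rw [h.cBar_eq, mul_div_assoc', div_lt_iff₀ h2]
  linarith

/-- For `q < 1` the exponent `b` is positive; for `q > 1` the condition `d * q < 1` says that `b <
-1`. -/
lemma add_one_mul_sub_nonpos (h : IsModel p d q) (hp : p ≠ 1 / 2) :
    (Real.log d / Real.log q + 1) * (q - 1) ≤ 0 := by
  have hq := h.odds_pos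
  rcases lt_or_gt_of_ne (fun hq1 => hp (h.odds_eq_one_iff.1 hq1) : q ≠ 1) with hq1 | hq1
  · have h1 := div_pos_of_neg_of_neg (Real.log_neg h.d_pos h.d_lt_one) (Real.log_neg hq hq1)
    exact mul_nonpos_of_nonneg_of_nonpos (by linarith) (by linarith)
  · have h1 := Real.log_neg (mul_pos h.d_pos hq) h.mul_lt
    rw [Real.log_mul h.d_pos.ne' hq.ne'] at h1
    have h2 : Real.log d / Real.log q < -1 := by
      rw [div_lt_iff₀ (Real.log_pos hq1)]; linarith
    exact mul_nonpos_of_nonpos_of_nonneg (by linarith) (by linarith)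

/-- For `c ≥ c̄` the second factor on the right is nonnegative, so the sign is governed by `q - 1`,
which pairs with the sign of `b + 1`. -/
lemma mul_upperFactor_sub (h : IsModel p d q) (c : ℝ) :
    c * upperFactor d q c - cBar p d ^ 2 * lowerFactor d q c
      = (q - 1) * ((c - cBar p d) * (cBar p d / q + (c - cBar p d) / ((1 - d) * q))) := by
  have h2 := h.odds_pos.ne'
  have h3 : 1 - d ≠ 0 := by linarith [h.d_lt_one]
  have h4 : 1 - d * q ≠ 0 := by linarith [h.mul_lt]
  have h4' : 1 - q * d ≠ 0 := by rwa [mul_comm]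
  have h5 : cBar p d * (1 - d * q) = q - d := by
    rw [h.cBar_eq]; field_simp
  rw [h.upperFactor_sub, h.lowerFactor_sub]
  generalize cBar p d = a at *
  field_simp
  linear_combination (-(a * (c - a))) * h5

/-- The factorization above replaces `c * upperFactor` by `c̄ ^ 2 * lowerFactor` in the favourable
direction. What remains is `(b + 1) c̄ < b - 1`, the inequality at `c̄` itself. -/
lemma logCost_deriv_neg (h : IsModel p d q) (hp : p ≠ 1 / 2) (hc : cBar p d ≤ c)
    (hB : 0 < upperFactor d q c) :
    lowerSlope d q * ((Real.log d / Real.log q + 1) / lowerFactor d q c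
        - (Real.log d / Real.log q - 1) * cBar p d / (c * upperFactor d q c)) < 0 := by
  have hcb := h.cBar_pos
  have hc0 := hcb.trans_le hc
  have hA := h.lowerFactor_pos hc
  have h1 := h.add_one_mul_cBar_lt hp
  have h2 := h.add_one_mul_sub_nonpos hp
  have h3 := h.mul_upperFactor_sub c
  set b := Real.log d / Real.log q
  have hd1 : 0 < 1 - d := by linarith [h.d_lt_one]
  have hq := h.odds_pos
  refine mul_neg_of_pos_of_neg h.lowerSlope_pos ?_
  rw [sub_neg, div_lt_div_iff₀ hA (mul_pos hc0 hB)]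
  have h4 : 0 ≤ (c - cBar p d) * (cBar p d / q + (c - cBar p d) / ((1 - d) * q)) := by
    have := sub_nonneg.2 hc
    positivity
  have h5 := mul_nonpos_of_nonpos_of_nonneg h2 h4
  have h6 := mul_lt_mul_of_pos_right h1 (mul_pos hcb hA)
  have h7 : (b + 1) * (c * upperFactor d q c) ≤ (b + 1) * (cBar p d ^ 2 * lowerFactor d q c) := by
    rw [← sub_nonpos, ← mul_sub, h3, ← mul_assoc]
    exact h5
  calc (b + 1) * (c * upperFactor d q c) ≤ (b + 1) * (cBar p d ^ 2 * lowerFactor d q c) := h7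
    _ = (b + 1) * cBar p d * (cBar p d * lowerFactor d q c) := by ring
    _ < (b - 1) * (cBar p d * lowerFactor d q c) := h6
    _ = _ := by ring

lemma strictMonoOn_costOfRatio (h : IsModel p d q) (hp : p ≠ 1 / 2) {e : ℝ}
    (he : e ∈ ratioInterval p d) : StrictMonoOn (costOfRatio p d) (Icc (cBar p d) e) := by
  have hpos : ∀ x ∈ Icc (cBar p d) e, 0 < x ∧ 0 < lowerFactor d q x ∧ 0 < upperFactor d q x :=
    fun x hx => ⟨h.cBar_pos.trans_le hx.1, h.lowerFactor_pos hx.1,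
      h.upperFactor_pos_of_le he hx.1 hx.2⟩
  have hanti : StrictAntiOn (logCost d q) (Icc (cBar p d) e) := by
    refine strictAntiOn_of_deriv_neg (convex_Icc _ _) (fun x hx => ?_) fun x hx => ?_
    · obtain ⟨h1, h2, h3⟩ := hpos x hx
      exact (h.hasDerivAt_logCost h1 h2 h3).continuousAt.continuousWithinAt
    · rw [interior_Icc] at hx
      obtain ⟨h1, h2, h3⟩ := hpos x (Ioo_subset_Icc_self hx)
      rw [(h.hasDerivAt_logCost h1 h2 h3).deriv]
      exact h.logCost_deriv_neg hp hx.1.le h3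
  intro x hx y hy hxy
  obtain ⟨h1, h2, h3⟩ := hpos x hx
  obtain ⟨h4, h5, h6⟩ := hpos y hy
  rw [h.costOfRatio_eq hp h1 h2 h3, h.costOfRatio_eq hp h4 h5 h6]
  have := Real.exp_lt_exp.2 (hanti hx hy hxy)
  linarith

lemma logCost_cBar (h : IsModel p d q) : logCost d q (cBar p d) = 0 := by
  rw [logCost, h.lowerFactor_cBar, h.upperFactor_cBar]
  simp

lemma upperFactor_cBar_pos (h : IsModel p d q) : 0 < upperFactor d q (cBar p d) := by
  rw [h.upperFactor_cBar]; exact h.cBar_pos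

lemma lowerFactor_cBar_pos (h : IsModel p d q) : 0 < lowerFactor d q (cBar p d) :=
  h.lowerFactor_pos le_rfl

lemma costOfRatio_cBar (h : IsModel p d q) (hp : p ≠ 1 / 2) :
    costOfRatio p d (cBar p d) = 0 := by
  rw [h.costOfRatio_eq hp h.cBar_pos h.lowerFactor_cBar_pos h.upperFactor_cBar_pos,
    h.logCost_cBar, Real.exp_zero, sub_self]

lemma eventually_factors_pos (h : IsModel p d q) : ∀ᶠ c in 𝓝 (cBar p d),
    0 < c ∧ 0 < lowerFactor d q c ∧ 0 < upperFactor d q c := by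
  refine (eventually_gt_nhds h.cBar_pos).and (Eventually.and ?_ ?_)
  · exact (hasDerivAt_lowerFactor d q _).continuousAt.eventually
      (eventually_gt_nhds h.lowerFactor_cBar_pos)
  · exact (h.hasDerivAt_upperFactor _).continuousAt.eventually
      (eventually_gt_nhds h.upperFactor_cBar_pos)

lemma costOfRatio_eventuallyEq (h : IsModel p d q) (hp : p ≠ 1 / 2) :
    costOfRatio p d =ᶠ[𝓝 (cBar p d)] fun c => 1 - Real.exp (logCost d q c) := by
  filter_upwards [h.eventually_factors_pos] with c hc
  exact h.costOfRatio_eq hp hc.1 hc.2.1 hc.2.2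

lemma analyticAt_costOfRatio (h : IsModel p d q) (hp : p ≠ 1 / 2) :
    AnalyticAt ℝ (costOfRatio p d) (cBar p d) := by
  refine AnalyticAt.congr ?_ (h.costOfRatio_eventuallyEq hp).symm
  have h1 := h.cBar_pos
  have h2 := h.lowerFactor_cBar_pos
  have h3 := h.upperFactor_cBar_pos
  have h4 := analyticAt_lowerFactor d q (cBar p d)
  have h5 := analyticAt_upperFactor d q (cBar p d)
  unfold logCost
  fun_prop (disch := assumption)

/-- The derivative of `F` at `c̄`, expressed by `η`. -/
lemma hasDerivAt_costOfRatio (h : IsModel p d q) (hp : p ≠ 1 / 2) :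
    HasDerivAt (costOfRatio p d)
      ((1 + q) * (1 - d * q) / (q * (q - d)) * ((1 + d) * eta p d - 1)) (cBar p d) := by
  refine HasDerivAt.congr_of_eventuallyEq ?_ (h.costOfRatio_eventuallyEq hp)
  have h1 := ((h.hasDerivAt_logCost h.cBar_pos h.lowerFactor_cBar_pos
    h.upperFactor_cBar_pos).exp).const_sub 1
  refine h1.congr_deriv ?_
  have h2 := h.odds_pos.ne'
  have h3 : 1 - d ≠ 0 := by linarith [h.d_lt_one]
  have h4 : 1 - d * q ≠ 0 := by linarith [h.mul_lt]
  have h4' : 1 - q * d ≠ 0 := by rwa [mul_comm]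
  have h5 : q - d ≠ 0 := by linarith [h.d_lt]
  have h6 := h.odds_pos
  rw [h.logCost_cBar, h.lowerFactor_cBar, h.upperFactor_cBar, Real.exp_zero, one_mul, h.eta_eq hp,
    h.cBar_eq, lowerSlope]
  generalize Real.log d / Real.log q = b
  field_simp
  ring

/-- The equation `F c = lam` has a solution. -/
lemma exists_costOfRatio_eq (h : IsModel p d q) (hp : p ≠ 1 / 2) {lam : ℝ}
    (hl : lam ∈ Ioo (0 : ℝ) 1) : ∃ c ∈ ratioInterval p d, costOfRatio p d c = lam := by
  have hq := h.odds_pos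
  have hd1 : 0 < 1 - d := by linarith [h.d_lt_one]
  have hcb := h.cBar_pos
  have hF0 := h.costOfRatio_cBar hp
  -- For `p < 1/2` the interval is unbounded and `F` tends to `1` at infinity; for `p > 1/2` the
  -- value `1` is attained at the finite right end, where `r` vanishes.
  rcases lt_or_gt_of_ne hp with hp' | hp'
  · have hq1 : 1 < q := by
      rcases lt_trichotomy q 1 with h0 | h0 | h0
      · linarith [h.odds_lt_one_iff.1 h0]
      · exact absurd (h.odds_eq_one_iff.1 h0) hp
      · exact h0
    have hs : 0 < 1 - lowerSlope d q := by
      rw [h.one_sub_lowerSlope]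
      exact div_pos (by linarith) (by positivity)
    have hpos : ∀ x, cBar p d ≤ x → 0 < x ∧ 0 < lowerFactor d q x ∧ 0 < upperFactor d q x := by
      intro x hx
      refine ⟨hcb.trans_le hx, h.lowerFactor_pos hx, ?_⟩
      rw [h.upperFactor_sub, ← h.one_sub_lowerSlope]
      have := mul_nonneg hs.le (sub_nonneg.2 hx)
      linarith
    have hcont : ContinuousOn (costOfRatio p d) (Ici (cBar p d)) := by
      have h1 : ContinuousOn (fun c => 1 - Real.exp (logCost d q c)) (Ici (cBar p d)) := by
        intro x hx
        obtain ⟨h1, h2, h3⟩ := hpos x hx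
        exact ((h.hasDerivAt_logCost h1 h2 h3).exp.const_sub
          1).continuousAt.continuousWithinAt
      refine h1.congr fun x hx => ?_
      obtain ⟨h1, h2, h3⟩ := hpos x hx
      exact h.costOfRatio_eq hp h1 h2 h3
    have hlim : Tendsto (costOfRatio p d) atTop (𝓝 1) := by
      have hA : Tendsto (lowerFactor d q) atTop atTop := by
        have h1 : Tendsto (fun c => lowerSlope d q * (c - cBar p d)) atTop atTop :=
          (tendsto_atTop_add_const_right _ _ tendsto_id).const_mul_atTop h.lowerSlope_pos
        refine (tendsto_atTop_add_const_left _ 1 h1).congr fun c => ?_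
        rw [h.lowerFactor_sub]
        rfl
      set b := Real.log d / Real.log q with hb
      have hb1 : b + 1 < 0 := by
        have h1 := Real.log_neg (mul_pos h.d_pos hq) h.mul_lt
        rw [Real.log_mul h.d_pos.ne' hq.ne'] at h1
        have h2 : b < -1 := by
          rw [hb, div_lt_iff₀ (Real.log_pos hq1)]; linarith
        linarith
      -- As `b - 1 < 0` and `upperFactor` is at least its slope times `c`, the second summand of
      -- `logCost` is bounded above, and the first tends to `-∞` because `b + 1 < 0`.
      have hbound : Tendsto (fun c => (b + 1) * Real.log (lowerFactor d q c)
          + (b - 1) * Real.log (1 - lowerSlope d q)) atTop atBot :=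
        tendsto_atBot_add_const_right _ _
          ((Real.tendsto_log_atTop.comp hA).const_mul_atTop_of_neg hb1)
      have hlogCost : Tendsto (logCost d q) atTop atBot := by
        refine tendsto_atBot_mono' atTop ?_ hbound
        filter_upwards [eventually_ge_atTop (cBar p d)] with x hx
        obtain ⟨h1, h2, h3⟩ := hpos x hx
        have h4 : (1 - lowerSlope d q) * x ≤ upperFactor d q x := by
          rw [h.upperFactor_sub, ← h.one_sub_lowerSlope]
          have := mul_pos h.lowerSlope_pos hcb
          linarith
        have h5 := Real.log_le_log (mul_pos hs h1) h4
        rw [Real.log_mul hs.ne' h1.ne'] at h5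
        have h6 : Real.log (1 - lowerSlope d q) ≤ Real.log (upperFactor d q x) - Real.log x := by
          linarith
        have h7 := mul_le_mul_of_nonpos_left h6 (by linarith : b - 1 ≤ 0)
        rw [logCost]
        linarith
      have h1 := (Real.tendsto_exp_atBot.comp hlogCost).const_sub 1
      rw [sub_zero] at h1
      refine h1.congr' ?_
      filter_upwards [eventually_ge_atTop (cBar p d)] with x hx
      obtain ⟨h1, h2, h3⟩ := hpos x hx
      exact (h.costOfRatio_eq hp h1 h2 h3).symm
    have hivt := isPreconnected_Ici.intermediate_value_Ico (self_mem_Ici (a := cBar p d))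
      (le_principal_iff.2 (Ici_mem_atTop _)) hcont hlim
    rw [hF0] at hivt
    obtain ⟨c, hc, hFc⟩ := hivt ⟨hl.1.le, hl.2⟩
    refine ⟨c, ?_, hFc⟩
    rw [ratioInterval, if_pos hp'.le]
    refine lt_of_le_of_ne (mem_Ici.1 hc) fun hcc => ?_
    rw [← hcc, hF0] at hFc
    exact hl.1.ne hFc
  · have hq1 : q < 1 := h.odds_lt_one_iff.2 hp'
    set e := (1 - p - p * d) / (2 * p - 1) with he
    have h2p : 0 < 2 * p - 1 := by linarith
    have hβ : 0 < 1 - p - p * d := by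
      nlinarith [mul_pos h.p_pos (sub_pos.2 h.d_lt), h.mul_odds]
    have hce : cBar p d < e := by
      rw [cBar, he]
      refine div_lt_div_of_pos_left hβ h2p ?_
      nlinarith [mul_pos (sub_pos.2 h.p_lt_one) hd1]
    -- The logarithmic form is not available at the end `e`, where `upperFactor` vanishes; the power
    -- is still continuous there because its exponent is nonnegative.
    have hcont : ContinuousOn (costOfRatio p d) (Icc (cBar p d) e) := by
      have hr : ContinuousOn (rAux p d) (Icc (cBar p d) e) := by
        unfold rAux
        refine ContinuousOn.div (by fun_prop) (by fun_prop) fun x hx => ?_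
        have h1 := hcb.trans_le hx.1
        have h2 := sub_pos.2 h.p_lt_one
        positivity
      have hb : 0 ≤ Real.log d / Real.log ((1 - p) / p) - 1 := by
        rw [← h.odds_eq]
        have h1 := Real.log_neg hq hq1
        have h2 := Real.log_lt_log h.d_pos h.d_lt
        rw [sub_nonneg, one_le_div_of_neg h1]
        exact h2.le
      have h1 := hr.rpow_const (p := Real.log d / Real.log ((1 - p) / p) - 1)
        fun x _ => Or.inr hb
      unfold costOfRatio
      simp only [if_neg hp]
      exact continuousOn_const.sub (ContinuousOn.mul (by fun_prop) h1)
    have hFe : costOfRatio p d e = 1 := by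
      have h1 : 1 - p - p * d - e * (2 * p - 1) = 0 := by
        rw [he, div_mul_cancel₀ _ h2p.ne', sub_self]
      have hb : Real.log d / Real.log ((1 - p) / p) - 1 ≠ 0 := by
        rw [← h.odds_eq]
        have h1 := Real.log_neg hq hq1
        have h2 := Real.log_lt_log h.d_pos h.d_lt
        have : 1 < Real.log d / Real.log q := by
          rw [one_lt_div_of_neg h1]; exact h2
        linarith
      rw [costOfRatio, if_neg hp, rAux, h1, mul_zero, zero_div, Real.zero_rpow hb]
      simp
    have hivt := intermediate_value_Ioo hce.le hcont
    rw [hF0, hFe] at hivt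
    obtain ⟨c, hc, hFc⟩ := hivt hl
    refine ⟨c, ?_, hFc⟩
    rw [ratioInterval, if_neg (by linarith)]
    exact hc

/-- By the definition of `k`, `q ^ k` is `r`, so `G` is rational in `c` apart from one logarithm. -/
lemma growthOfRatio_eq (h : IsModel p d q) (hp : p ≠ 1 / 2) (hc : 0 < c)
    (hA : 0 < lowerFactor d q c) (hB : 0 < upperFactor d q c) :
    growthOfRatio p d c = growthAux p d q c := by
  have hr : 0 < lowerFactor d q c * upperFactor d q c / c := by positivity
  have hq := h.odds_pos
  have hd := h.d_pos
  have hp0 := h.p_pos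
  have hinv : p / (1 - p) = q⁻¹ := by rw [h.odds_eq, inv_div]
  have hpow : q⁻¹ ^ netSteps p d c = (lowerFactor d q c * upperFactor d q c / c)⁻¹ := by
    have hlq := h.log_odds_ne_zero hp
    rw [netSteps, if_neg hp, h.rAux_eq, ← h.odds_eq, Real.inv_rpow hq.le,
      Real.rpow_def_of_pos hq, mul_div_cancel₀ _ hlq, Real.exp_log hr]
  have hlog : (c + d) * p / ((c + 1) * (1 - p) * d) = (c + d) / (c + 1) / (q * d) := by
    rw [← h.mul_odds]
    field_simp
  have hlog2 : Real.log ((c + d) / (c + 1) / (q * d))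
      = Real.log ((c + d) / (c + 1)) - Real.log (q * d) :=
    Real.log_div (by positivity) (by positivity)
  rw [growthOfRatio, if_neg hp, hinv, Real.rpow_add_one (inv_pos.2 hq).ne', hpow, hlog, hlog2,
    growthAux, lowerLog, ← h.mul_odds]
  have h5 : 1 - 2 * p = p * (q - 1) := by linear_combination -h.mul_odds
  rw [h5]
  generalize lowerFactor d q c * upperFactor d q c / c = r at *
  generalize Real.log ((c + d) / (c + 1)) = l at *
  generalize Real.log (q * d) = K at *
  have h6 : 1 - r⁻¹ * q⁻¹ = (q * r - 1) / (q * r) := by field_simp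
  rw [h6]
  -- If `q * r = 1` both sides are divisions by zero and hence `0`.
  by_cases h7 : q * r - 1 = 0
  · simp [h7]
  · field_simp
    ring

/-- For `c > c̄` this gives `r - 1` the sign of `q - 1`, which keeps the denominator `q * r - 1` of
`G` away from `0`. -/
lemma rAux_sub_one (h : IsModel p d q) (c : ℝ) :
    lowerFactor d q c * upperFactor d q c - c
      = (q - 1) * (lowerSlope d q * ((c - cBar p d)
        * ((1 + d) / (1 - d * q) + (c - cBar p d) / ((1 - d) * q)))) := by
  have h2 := h.odds_pos.ne'
  have h3 : 1 - d ≠ 0 := by linarith [h.d_lt_one]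
  have h4 : 1 - d * q ≠ 0 := by linarith [h.mul_lt]
  have h4' : 1 - q * d ≠ 0 := by rwa [mul_comm]
  have h5 : cBar p d * (1 - d * q) = q - d := by
    rw [h.cBar_eq]; field_simp
  have h6 : (q - 1) * ((1 + d) / (1 - d * q)) = cBar p d - 1 := by
    rw [h.cBar_eq]; field_simp; ring
  have h7 : (q - 1) * (lowerSlope d q * ((c - cBar p d)
        * ((1 + d) / (1 - d * q) + (c - cBar p d) / ((1 - d) * q))))
      = lowerSlope d q * (c - cBar p d) * ((q - 1) * ((1 + d) / (1 - d * q))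
        + (q - 1) / ((1 - d) * q) * (c - cBar p d)) := by ring
  rw [h7, h6, ← h.one_sub_lowerSlope, h.upperFactor_sub, h.lowerFactor_sub,
    ← h.one_sub_lowerSlope, ← lowerSlope]
  ring

/-- The function `G` is bounded. -/
lemma abs_growthOfRatio_le (h : IsModel p d q) (hp : p ≠ 1 / 2) (hc : c ∈ ratioInterval p d) :
    |growthOfRatio p d c| ≤ 2 * -Real.log d + |Real.log (q * d)| := by
  have hc0 := h.pos_of_mem hc
  have hcb := cBar_lt_of_mem hc
  have hA := h.lowerFactor_pos hcb.le
  have hB := h.upperFactor_pos hc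
  have hl := abs_lowerLog_le h.d_pos h.d_lt_one hc0.le
  have hq := h.odds_pos
  have hp0 := h.p_pos
  have hp1 := h.p_lt_one
  have hd := h.d_pos
  have hd1 : 0 < 1 - d := by linarith [h.d_lt_one]
  have hdq : 0 < 1 - d * q := by linarith [h.mul_lt]
  have hr0 : 0 < lowerFactor d q c * upperFactor d q c / c := by positivity
  have hs : 0 < lowerSlope d q * ((c - cBar p d)
      * ((1 + d) / (1 - d * q) + (c - cBar p d) / ((1 - d) * q))) := by
    have := h.lowerSlope_pos
    have := sub_pos.2 hcb
    positivity
  have hr := h.rAux_sub_one c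
  have hr1 : lowerFactor d q c * upperFactor d q c / c - 1 = (q - 1) * (lowerSlope d q
      * ((c - cBar p d) * ((1 + d) / (1 - d * q) + (c - cBar p d) / ((1 - d) * q))) / c) := by
    rw [← mul_div_assoc, ← hr]
    field_simp
  have hs' := div_pos hs hc0
  rw [h.growthOfRatio_eq hp hc0 hA hB, growthAux]
  have hq1 : q ≠ 1 := fun hq => hp (h.odds_eq_one_iff.1 hq)
  have hpq := h.mul_odds
  generalize lowerFactor d q c * upperFactor d q c / c = r at *
  generalize lowerSlope d q
      * ((c - cBar p d) * ((1 + d) / (1 - d * q) + (c - cBar p d) / ((1 - d) * q))) / c = s at *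
  generalize lowerLog d c = l at *
  generalize Real.log (q * d) = K at *
  have hpp : p * (1 + q) = 1 := by linarith
  have hKn := abs_nonneg K
  have hln := abs_nonneg l
  rw [abs_div, abs_mul, abs_mul, abs_of_pos hp0]
  have htri : |q * r * l + l - K| ≤ (q * r + 1) * |l| + |K| := by
    calc |q * r * l + l - K| ≤ |q * r * l + l| + |K| := abs_sub _ _
      _ = |(q * r + 1) * l| + |K| := by ring_nf
      _ = (q * r + 1) * |l| + |K| := by
        rw [abs_mul, abs_of_pos (by positivity : 0 < q * r + 1)]
  rcases lt_or_gt_of_ne hq1 with h1 | h1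
  · have hr2 : r < 1 := by nlinarith
    have hqr : q * r < q := by nlinarith
    rw [abs_of_neg (by linarith : q - 1 < 0), abs_of_neg (by linarith : q * r - 1 < 0),
      div_le_iff₀ (by linarith)]
    have h2 : |q * r * l + l - K| ≤ 2 * |l| + |K| := by nlinarith
    have h3 : 0 ≤ 2 * |l| + |K| := by positivity
    calc p * -(q - 1) * |q * r * l + l - K| ≤ p * -(q - 1) * (2 * |l| + |K|) :=
          mul_le_mul_of_nonneg_left h2 (mul_nonneg hp0.le (by linarith))
      _ ≤ -(q * r - 1) * (2 * |l| + |K|) := by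
          refine mul_le_mul_of_nonneg_right ?_ h3
          nlinarith
      _ ≤ -(q * r - 1) * (2 * -Real.log d + |K|) := by
          refine mul_le_mul_of_nonneg_left ?_ (by linarith)
          linarith
      _ = _ := by ring
  · have hr2 : 1 < r := by nlinarith
    have hqr : q < q * r := by nlinarith
    rw [abs_of_pos (by linarith : 0 < q - 1), abs_of_pos (by linarith : 0 < q * r - 1),
      div_le_iff₀ (by linarith)]
    -- Here `r` may be large, so the numerator is compared with the denominator; this inequality
    -- reduces to `r ≥ 1`, and `p * (1 + q) = 1` absorbs the constant.
    have h3 : (q - 1) * (q * r + 1) ≤ (1 + q) * (q * r - 1) := by nlinarith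
    calc p * (q - 1) * |q * r * l + l - K| ≤ p * (q - 1) * ((q * r + 1) * |l| + |K|) :=
          mul_le_mul_of_nonneg_left htri (mul_nonneg hp0.le (by linarith))
      _ = p * ((q - 1) * (q * r + 1)) * |l| + p * (q - 1) * |K| := by ring
      _ ≤ p * ((1 + q) * (q * r - 1)) * |l| + (q * r - 1) * |K| := by
          refine add_le_add (mul_le_mul_of_nonneg_right
            (mul_le_mul_of_nonneg_left h3 hp0.le) hln) (mul_le_mul_of_nonneg_right ?_ hKn)
          nlinarith
      _ = (q * r - 1) * (|l| + |K|) := by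
          rw [← mul_assoc, hpp]; ring
      _ ≤ (q * r - 1) * (2 * -Real.log d + |K|) := by
          refine mul_le_mul_of_nonneg_left ?_ (by linarith)
          linarith
      _ = _ := by ring

lemma growthOfRatio_eventuallyEq (h : IsModel p d q) (hp : p ≠ 1 / 2) :
    growthOfRatio p d =ᶠ[𝓝 (cBar p d)] growthAux p d q := by
  filter_upwards [h.eventually_factors_pos] with c hc
  exact h.growthOfRatio_eq hp hc.1 hc.2.1 hc.2.2

lemma analyticAt_growthOfRatio (h : IsModel p d q) (hp : p ≠ 1 / 2) :
    AnalyticAt ℝ (growthOfRatio p d) (cBar p d) := by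
  refine AnalyticAt.congr ?_ (h.growthOfRatio_eventuallyEq hp).symm
  have h1 := h.cBar_pos.ne'
  have h4 := analyticAt_lowerFactor d q (cBar p d)
  have h5 := analyticAt_upperFactor d q (cBar p d)
  have h6 := analyticAt_lowerLog h.d_pos h.cBar_pos
  have h7 : q * (lowerFactor d q (cBar p d) * upperFactor d q (cBar p d) / cBar p d) - 1 ≠ 0 := by
    rw [h.lowerFactor_cBar, h.upperFactor_cBar, one_mul, div_self h1, mul_one]
    exact sub_ne_zero.2 fun hq => hp (h.odds_eq_one_iff.1 hq)
  unfold growthAux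
  fun_prop (disch := assumption)

lemma cBar_ratio (h : IsModel p d q) :
    (cBar p d + d) / (cBar p d + 1) = (1 + d) * q / (1 + q) := by
  have h2 := h.odds_pos
  have h3 : 1 - d ≠ 0 := by linarith [h.d_lt_one]
  have h4 : 1 - d * q ≠ 0 := by linarith [h.mul_lt]
  have h4' : 1 - q * d ≠ 0 := by rwa [mul_comm]
  have h5 := h.cBar_pos
  have h7 : q - d + (1 - d * q) ≠ 0 := by linarith [h.d_lt, h.mul_lt]
  rw [div_eq_div_iff (by positivity) (by positivity), h.cBar_eq]
  field_simp
  ring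

lemma growthOfRatio_cBar (h : IsModel p d q) (hp : p ≠ 1 / 2) :
    growthOfRatio p d (cBar p d) = growthCoeffZero p d := by
  have hc := h.cBar_pos
  have hd := h.d_pos
  have hq := h.odds_pos
  have hp0 := h.p_pos
  have hp1 : 0 < 1 - p := sub_pos.2 h.p_lt_one
  have hq1 : q - 1 ≠ 0 := sub_ne_zero.2 fun hq => hp (h.odds_eq_one_iff.1 hq)
  have hlog : lowerLog d (cBar p d) = Real.log (1 + d) + Real.log (1 - p) := by
    rw [lowerLog, h.cBar_ratio, ← Real.log_mul (by positivity) hp1.ne', ← h.mul_odds]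
    congr 1
    rw [h.prob_eq]
    field_simp
  have hlq : Real.log q = Real.log (1 - p) - Real.log p := by
    rw [h.odds_eq, Real.log_div hp1.ne' hp0.ne']
  rw [h.growthOfRatio_eq hp hc h.lowerFactor_cBar_pos h.upperFactor_cBar_pos, growthAux,
    h.lowerFactor_cBar, h.upperFactor_cBar, hlog, one_mul, div_self hc.ne', mul_one,
    Real.log_mul hq.ne' hd.ne', hlq, growthCoeffZero, Real.log_div (by positivity) (by positivity),
    Real.log_mul (by positivity) (by positivity), Real.log_mul (by positivity) (by positivity),
    Real.log_rpow hp0, Real.log_rpow hp1, Real.log_rpow hd]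
  have hpq := h.mul_odds
  generalize Real.log (1 + d) = a
  generalize Real.log (1 - p) = b
  generalize Real.log p = e
  generalize Real.log d = f
  field_simp
  linear_combination (a + b) * hpq

/-- The derivatives of `F` and `G` at `c̄` are related by the first-order coefficient. -/
lemma hasDerivAt_growthOfRatio (h : IsModel p d q) (hp : p ≠ 1 / 2) :
    HasDerivAt (growthOfRatio p d) (growthCoeffOne p d *
      ((1 + q) * (1 - d * q) / (q * (q - d)) * ((1 + d) * eta p d - 1))) (cBar p d) := by
  refine HasDerivAt.congr_of_eventuallyEq ?_ (h.growthOfRatio_eventuallyEq hp)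
  have hc := h.cBar_pos
  have hd := h.d_pos
  have hq := h.odds_pos
  have hp0 := h.p_pos
  have hp1 : 0 < 1 - p := sub_pos.2 h.p_lt_one
  have hq1 : q - 1 ≠ 0 := sub_ne_zero.2 fun hq => hp (h.odds_eq_one_iff.1 hq)
  have h3 : 1 - d ≠ 0 := by linarith [h.d_lt_one]
  have h4 : 1 - d * q ≠ 0 := by linarith [h.mul_lt]
  have h4' : 1 - q * d ≠ 0 := by rwa [mul_comm]
  have h5 : q - d ≠ 0 := by linarith [h.d_lt]
  have hr := ((hasDerivAt_lowerFactor d q (cBar p d)).mul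
    (h.hasDerivAt_upperFactor (cBar p d))).div (hasDerivAt_id (cBar p d)) hc.ne'
  have hr' : HasDerivAt (fun c => lowerFactor d q c * upperFactor d q c / c)
      (lowerSlope d q * (cBar p d - 1) / cBar p d) (cBar p d) := by
    refine hr.congr_deriv ?_
    simp only [id, Pi.mul_apply, h.lowerFactor_cBar, h.upperFactor_cBar]
    field_simp
    ring
  have hl := hasDerivAt_lowerLog hd hc
  have hden : q * (lowerFactor d q (cBar p d) * upperFactor d q (cBar p d) / cBar p d) - 1
      ≠ 0 := by
    rwa [h.lowerFactor_cBar, h.upperFactor_cBar, one_mul, div_self hc.ne', mul_one]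
  have hG := ((((((hr'.const_mul q).mul hl).add hl).sub_const (Real.log (q * d))).const_mul
    (p * (q - 1))).div ((hr'.const_mul q).sub_const 1) hden)
  refine hG.congr_deriv ?_
  have hE : (1 + d) * eta p d - 1 ≠ 0 := by linarith [h.one_lt_mul_eta]
  have hZ : Real.log ((1 + d) ^ 2 * (1 - p) * p / d)
      = 2 * lowerLog d (cBar p d) - Real.log (q * d) := by
    rw [lowerLog, h.cBar_ratio, ← Real.log_rpow (by positivity),
      ← Real.log_div (by positivity) (by positivity), ← h.mul_odds]
    congr 1
    rw [h.prob_eq]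
    norm_cast
    field_simp
  -- The factor `(1 + d) η - 1` of `F'` cancels the one in the denominator of `R₁`, so `η` drops
  -- out, as it must: `G` does not involve it.
  have hR : growthCoeffOne p d * ((1 + q) * (1 - d * q) / (q * (q - d)) * ((1 + d) * eta p d - 1))
      = ((p + p * d - d) * (1 - p - p * d)
      - (1 + d) ^ 2 * (1 - p) * p * (2 * lowerLog d (cBar p d) - Real.log (q * d)))
        * ((1 + q) * (1 - d * q) / (q * (q - d))) / (1 - d ^ 2) := by
    rw [growthCoeffOne, hZ]
    generalize (1 + d) * eta p d - 1 = E at *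
    have : 1 - d ^ 2 ≠ 0 := by
      have : 1 + d ≠ 0 := by positivity
      rw [show 1 - d ^ 2 = (1 - d) * (1 + d) by ring]
      exact mul_ne_zero h3 this
    field_simp
  rw [hR]
  simp only [Pi.mul_apply, Pi.add_apply, h.lowerFactor_cBar, h.upperFactor_cBar, one_mul,
    div_self hc.ne', mul_one]
  generalize lowerLog d (cBar p d) = l
  generalize Real.log (q * d) = K
  have e1 : cBar p d + d = q * (1 - d ^ 2) / (1 - d * q) := by
    rw [h.cBar_eq]; field_simp; ring
  have e2 : cBar p d + 1 = (1 - d) * (1 + q) / (1 - d * q) := by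
    rw [h.cBar_eq]; field_simp; ring
  have e3 : cBar p d - 1 = (q - 1) * (1 + d) / (1 - d * q) := by
    rw [h.cBar_eq]; field_simp; ring
  have e4 : 1 - d ^ 2 = (1 - d) * (1 + d) := by ring
  rw [e1, e2, e3, h.cBar_eq, lowerSlope, e4, h.prob_eq]
  field_simp
  ring

end IsModel

/-! ### The functions `F` and `G` for `p = 1 / 2` -/

lemma costOfRatio_half {d c : ℝ} (hd : 0 < d) :
    costOfRatio (1 / 2) d c
      = 1 - c ^ 2 * Real.exp (Real.log d * ((c + d) * (c - 1) / (c * (1 - d)))) := by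
  rw [costOfRatio, if_pos rfl, Real.rpow_def_of_pos hd]

lemma cBar_half {d : ℝ} (hd1 : d < 1) : cBar (1 / 2) d = 1 := by
  rw [cBar, div_eq_one_iff_eq (by linarith)]
  ring

lemma ratioInterval_half {d : ℝ} (hd1 : d < 1) : ratioInterval (1 / 2) d = Ioi 1 := by
  rw [ratioInterval, if_pos le_rfl, cBar_half hd1]

lemma costOfRatio_half_one {d : ℝ} (hd : 0 < d) : costOfRatio (1 / 2) d 1 = 0 := by
  rw [costOfRatio_half hd]; simp

lemma hasDerivAt_costOfRatio_half {d c : ℝ} (hd : 0 < d) (hd1 : d < 1) (hc : 0 < c) :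
    HasDerivAt (costOfRatio (1 / 2) d)
      (-(Real.exp (Real.log d * ((c + d) * (c - 1) / (c * (1 - d))))
        * (2 * c + Real.log d * (c ^ 2 + d) / (1 - d)))) c := by
  have h0 : c * (1 - d) ≠ 0 := mul_ne_zero hc.ne' (by linarith)
  have h1 : 1 - d ≠ 0 := by linarith
  have hk := (((hasDerivAt_id c).add_const d).mul ((hasDerivAt_id c).sub_const 1)).div
    ((hasDerivAt_id c).mul_const (1 - d)) h0
  have hF := (((hasDerivAt_id c).pow 2).mul (hk.const_mul (Real.log d)).exp).const_sub 1
  have he : costOfRatio (1 / 2) d = fun c => 1 - c ^ 2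
      * Real.exp (Real.log d * ((c + d) * (c - 1) / (c * (1 - d)))) := by
    funext c
    exact costOfRatio_half hd
  rw [he]
  refine hF.congr_deriv ?_
  simp only [id, Pi.mul_apply, Pi.div_apply, Pi.pow_apply]
  generalize Real.exp (Real.log d * ((c + d) * (c - 1) / (c * (1 - d)))) = E
  generalize Real.log d = L
  field_simp
  push_cast
  ring

/-- From `(x - 1) * (x - d) ≥ 0` comes `x ^ 2 + d ≥ x * (1 + d)`, which reduces the sign of the
derivative to its sign at `x = 1`. -/
lemma strictMonoOn_costOfRatio_half {d : ℝ} (hd : 0 < d) (hd1 : d < 1) :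
    StrictMonoOn (costOfRatio (1 / 2) d) (Ici 1) := by
  refine strictMonoOn_of_deriv_pos (convex_Ici 1) (fun x hx => ?_) fun x hx => ?_
  · have hx1 : (1 : ℝ) ≤ x := hx
    exact (hasDerivAt_costOfRatio_half hd hd1 (by linarith)).continuousAt.continuousWithinAt
  · rw [interior_Ici] at hx
    have hx1 : (1 : ℝ) < x := hx
    rw [(hasDerivAt_costOfRatio_half hd hd1 (by linarith)).deriv, Left.neg_pos_iff]
    refine mul_neg_of_pos_of_neg (Real.exp_pos _) ?_
    have h1 : 0 < 1 - d := by linarith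
    have h2 := log_mul_div_lt_neg_two hd hd1
    have h3 := Real.log_neg hd hd1
    have h4 : x * (1 + d) ≤ x ^ 2 + d := by nlinarith
    have h5 := mul_le_mul_of_nonpos_left h4 h3.le
    have h6 : Real.log d * (x ^ 2 + d) < -(2 * x) * (1 - d) := by nlinarith
    have h7 := (div_lt_iff₀ h1).2 h6
    linarith

lemma exists_costOfRatio_half_eq {d : ℝ} (hd : 0 < d) (hd1 : d < 1) {lam : ℝ}
    (hl : lam ∈ Ioo (0 : ℝ) 1) :
    ∃ c ∈ ratioInterval (1 / 2) d, costOfRatio (1 / 2) d c = lam := by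
  have h1 : 0 < 1 - d := by linarith
  have hL := Real.log_neg hd hd1
  have hcont : ContinuousOn (costOfRatio (1 / 2) d) (Ici 1) := fun x hx =>
    (hasDerivAt_costOfRatio_half hd hd1
      (zero_lt_one.trans_le hx)).continuousAt.continuousWithinAt
  have hlim : Tendsto (costOfRatio (1 / 2) d) atTop (𝓝 1) := by
    have ha : 0 < -Real.log d / (1 - d) := div_pos (by linarith) h1
    have hexp : Tendsto (fun c : ℝ => c ^ (2 : ℝ) * Real.exp (-(-Real.log d / (1 - d)) * c)) atTop
        (𝓝 0) := tendsto_rpow_mul_exp_neg_mul_atTop_nhds_zero 2 _ ha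
    have hexp2 := hexp.mul_const (Real.exp (-Real.log d / (1 - d)))
    rw [zero_mul] at hexp2
    have h0 : Tendsto (fun c : ℝ => c ^ 2
        * Real.exp (Real.log d * ((c + d) * (c - 1) / (c * (1 - d))))) atTop (𝓝 0) := by
      refine squeeze_zero' (Eventually.of_forall fun c => by positivity) ?_ hexp2
      filter_upwards [eventually_ge_atTop 1] with c hc
      have hc0 : 0 < c := by linarith
      rw [Real.rpow_ofNat, mul_assoc, ← Real.exp_add]
      refine mul_le_mul_of_nonneg_left (Real.exp_le_exp.2 ?_) (sq_nonneg c)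
      -- Since `(c + d) / c ≥ 1`, the exponent is at least linear in `c`, and exponential decay
      -- beats `c ^ 2`.
      have h2 : (c - 1) / (1 - d) ≤ (c + d) * (c - 1) / (c * (1 - d)) := by
        rw [div_le_div_iff₀ h1 (by positivity)]
        nlinarith [mul_nonneg (mul_nonneg hd.le (sub_nonneg.2 hc)) h1.le]
      refine (mul_le_mul_of_nonpos_left h2 hL.le).trans (le_of_eq ?_)
      ring
    have h2 := h0.const_sub 1
    rw [sub_zero] at h2
    refine h2.congr fun c => ?_
    rw [costOfRatio_half hd]
  have hivt := isPreconnected_Ici.intermediate_value_Ico (self_mem_Ici (a := (1 : ℝ)))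
    (le_principal_iff.2 (Ici_mem_atTop _)) hcont hlim
  rw [costOfRatio_half_one hd] at hivt
  obtain ⟨c, hc, hFc⟩ := hivt ⟨hl.1.le, hl.2⟩
  refine ⟨c, ?_, hFc⟩
  rw [ratioInterval_half hd1]
  refine lt_of_le_of_ne (mem_Ici.1 hc) fun hcc => ?_
  rw [← hcc, costOfRatio_half_one hd] at hFc
  exact hl.1.ne hFc

lemma growthOfRatio_half {d c : ℝ} (hd : 0 < d) (hc : 0 < c) :
    growthOfRatio (1 / 2) d c
      = c * (1 - d) / (c ^ 2 - d) * (lowerLog d c - Real.log d / 2) := by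
  have h1 : 0 < Real.sqrt d := Real.sqrt_pos.2 hd
  rw [growthOfRatio, if_pos rfl, lowerLog, Real.log_div (by positivity) (by positivity),
    Real.log_mul (by positivity) (by positivity),
    Real.log_div (by positivity) (by positivity), Real.log_sqrt hd.le]
  ring

lemma growthOfRatio_half_eventuallyEq {d : ℝ} (hd : 0 < d) :
    growthOfRatio (1 / 2) d =ᶠ[𝓝 1]
      fun c => c * (1 - d) / (c ^ 2 - d) * (lowerLog d c - Real.log d / 2) := by
  filter_upwards [eventually_gt_nhds one_pos] with c hc
  exact growthOfRatio_half hd hc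

/-- The prefactor is at most `1` because `c ^ 2 - d - c * (1 - d) = (c - 1) * (c + d)`. -/
lemma abs_growthOfRatio_half_le {d c : ℝ} (hd : 0 < d) (hd1 : d < 1) (hc : 1 < c) :
    |growthOfRatio (1 / 2) d c| ≤ 2 * -Real.log d := by
  have hL := Real.log_neg hd hd1
  have hl := abs_lowerLog_le hd hd1 (by linarith : 0 ≤ c)
  have h1 : 0 < c ^ 2 - d := by nlinarith
  have h2 : 0 ≤ c * (1 - d) / (c ^ 2 - d) :=
    div_nonneg (mul_nonneg (by linarith) (by linarith)) h1.le
  have h3 : c * (1 - d) / (c ^ 2 - d) ≤ 1 := by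
    rw [div_le_one h1]
    nlinarith [mul_pos (sub_pos.2 hc) (add_pos (zero_lt_one.trans hc) hd)]
  rw [growthOfRatio_half hd (by linarith), abs_mul, abs_of_nonneg h2]
  refine (mul_le_of_le_one_left (abs_nonneg _) h3).trans ?_
  rw [abs_le] at hl ⊢
  constructor <;> linarith [hl.1, hl.2]

lemma analyticAt_costOfRatio_half {d : ℝ} (hd : 0 < d) (hd1 : d < 1) :
    AnalyticAt ℝ (costOfRatio (1 / 2) d) 1 := by
  have he : costOfRatio (1 / 2) d = fun c => 1 - c ^ 2
      * Real.exp (Real.log d * ((c + d) * (c - 1) / (c * (1 - d)))) := by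
    funext c
    exact costOfRatio_half hd
  have h0 : (1 : ℝ) * (1 - d) ≠ 0 := mul_ne_zero one_ne_zero (by linarith)
  rw [he]
  fun_prop (disch := assumption)

lemma analyticAt_growthOfRatio_half {d : ℝ} (hd : 0 < d) (hd1 : d < 1) :
    AnalyticAt ℝ (growthOfRatio (1 / 2) d) 1 := by
  refine AnalyticAt.congr ?_ (growthOfRatio_half_eventuallyEq hd).symm
  have h0 : (1 : ℝ) ^ 2 - d ≠ 0 := by linarith
  have h1 := analyticAt_lowerLog hd one_pos
  fun_prop (disch := assumption)

lemma lowerLog_one {d : ℝ} (hd : 0 < d) : lowerLog d 1 = Real.log (1 + d) - Real.log 2 := by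
  rw [lowerLog, Real.log_div (by positivity) (by norm_num)]
  norm_num

lemma growthOfRatio_half_one {d : ℝ} (hd : 0 < d) (hd1 : d < 1) :
    growthOfRatio (1 / 2) d 1 = growthCoeffZero (1 / 2) d := by
  have h0 : 1 - d ≠ 0 := by linarith
  rw [growthOfRatio_half hd one_pos, lowerLog_one hd, growthCoeffZero,
    Real.log_div (by positivity) (by positivity), Real.log_mul (by positivity) (by positivity),
    Real.log_mul (by positivity) (by positivity), Real.log_rpow (by norm_num),
    Real.log_rpow (by norm_num), Real.log_rpow hd]
  rw [show (1 : ℝ) - 1 / 2 = 1 / 2 by norm_num, one_div, Real.log_inv]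
  field_simp
  ring

lemma hasDerivAt_growthOfRatio_half {d : ℝ} (hd : 0 < d) (hd1 : d < 1)
    (hE : (1 + d) * eta (1 / 2) d - 1 ≠ 0) :
    HasDerivAt (growthOfRatio (1 / 2) d) (growthCoeffOne (1 / 2) d
      * (2 * ((1 + d) * eta (1 / 2) d - 1))) 1 := by
  refine HasDerivAt.congr_of_eventuallyEq ?_ (growthOfRatio_half_eventuallyEq hd)
  have h0 : 1 - d ≠ 0 := by linarith
  have h1 : (1 : ℝ) ^ 2 - d ≠ 0 := by linarith
  have h2 : 1 + d ≠ 0 := by positivity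
  have hG := (((hasDerivAt_id (1 : ℝ)).mul_const (1 - d)).div
    (((hasDerivAt_id (1 : ℝ)).pow 2).sub_const d) h1).mul
      ((hasDerivAt_lowerLog hd one_pos).sub_const (Real.log d / 2))
  refine hG.congr_deriv ?_
  have hZ : Real.log ((1 + d) ^ 2 * (1 - 1 / 2) * (1 / 2) / d)
      = 2 * lowerLog d 1 - Real.log d := by
    rw [lowerLog_one hd, show (1 + d) ^ 2 * (1 - 1 / 2) * (1 / 2) / d = ((1 + d) / 2) ^ 2 / d by
      ring, Real.log_div (by positivity) hd.ne', Real.log_pow,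
      Real.log_div h2 (by norm_num)]
    push_cast
    ring
  rw [growthCoeffOne, hZ]
  generalize (1 + d) * eta (1 / 2) d - 1 = E at *
  have h3 : 1 - d ^ 2 = (1 - d) * (1 + d) := by ring
  simp only [id, Pi.div_apply, Pi.pow_apply, h3, one_pow]
  generalize lowerLog d 1 = l
  generalize Real.log d = L
  push_cast
  field_simp
  ring

/-! ### Existence and uniqueness of the ratio, and the expansion -/

namespace IsModel

variable {p d q : ℝ}

lemma strictMonoOn_costOfRatio_Icc (h : IsModel p d q) {e : ℝ} (he : e ∈ ratioInterval p d) :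
    StrictMonoOn (costOfRatio p d) (Icc (cBar p d) e) := by
  by_cases hp : p = 1 / 2
  · subst hp
    refine (strictMonoOn_costOfRatio_half h.d_pos h.d_lt_one).mono ?_
    rw [cBar_half h.d_lt_one]
    exact Icc_subset_Ici_self
  · exact h.strictMonoOn_costOfRatio hp he

lemma exists_ratio (h : IsModel p d q) {lam : ℝ} (hl : lam ∈ Ioo (0 : ℝ) 1) :
    ∃ c ∈ ratioInterval p d, costOfRatio p d c = lam := by
  by_cases hp : p = 1 / 2
  · subst hp
    exact exists_costOfRatio_half_eq h.d_pos h.d_lt_one hl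
  · exact h.exists_costOfRatio_eq hp hl

lemma injOn_costOfRatio (h : IsModel p d q) : InjOn (costOfRatio p d) (ratioInterval p d) := by
  have key : ∀ x ∈ ratioInterval p d, ∀ y ∈ ratioInterval p d, x < y →
      costOfRatio p d x < costOfRatio p d y := fun x hx y hy hxy =>
    h.strictMonoOn_costOfRatio_Icc hy ⟨(cBar_lt_of_mem hx).le, hxy.le⟩
      ⟨(cBar_lt_of_mem hy).le, le_rfl⟩ hxy
  intro x hx y hy hxy
  rcases lt_trichotomy x y with h1 | h1 | h1
  · exact absurd hxy (key x hx y hy h1).ne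
  · exact h1
  · exact absurd hxy (key y hy x hx h1).ne'

lemma exists_expansion (h : IsModel p d q) : ∃ C : ℝ, ∀ c ∈ ratioInterval p d,
    costOfRatio p d c < 1 → |growthOfRatio p d c
      - (growthCoeffZero p d + growthCoeffOne p d * costOfRatio p d c)|
        ≤ C * costOfRatio p d c ^ 2 := by
  have hE : 0 < (1 + d) * eta p d - 1 := sub_pos.2 h.one_lt_mul_eta
  have hd := h.d_pos
  have hd1 := h.d_lt_one
  have hmono : ∀ x ∈ ratioInterval p d, StrictMonoOn (costOfRatio p d) (Icc (cBar p d) x) :=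
    fun x hx => h.strictMonoOn_costOfRatio_Icc hx
  by_cases hp : p = 1 / 2
  · subst hp
    have hF : HasDerivAt (costOfRatio (1 / 2) d) (2 * ((1 + d) * eta (1 / 2) d - 1)) 1 := by
      refine (hasDerivAt_costOfRatio_half hd hd1 one_pos).congr_deriv ?_
      have h0 : 1 - d ≠ 0 := by linarith
      rw [eta, if_pos rfl]
      simp
      field_simp
      ring
    rw [cBar_half hd1, ratioInterval_half hd1] at hmono
    rw [ratioInterval_half hd1]
    exact exists_abs_sub_le_sq (fun x hx => hx) (costOfRatio_half_one hd)
      (growthOfRatio_half_one hd hd1) (mul_pos two_pos hE) hF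
      (hasDerivAt_growthOfRatio_half hd hd1 hE.ne') (analyticAt_costOfRatio_half hd hd1)
      (analyticAt_growthOfRatio_half hd hd1) hmono
      fun x hx => abs_growthOfRatio_half_le hd hd1 hx
  · have h1 : 0 < 1 - d * q := by linarith [h.mul_lt]
    have h2 : 0 < q - d := by linarith [h.d_lt]
    have h3 := h.odds_pos
    exact exists_abs_sub_le_sq (fun x hx => cBar_lt_of_mem hx) (h.costOfRatio_cBar hp)
      (h.growthOfRatio_cBar hp) (mul_pos (by positivity) hE) (h.hasDerivAt_costOfRatio hp)
      (h.hasDerivAt_growthOfRatio hp) (h.analyticAt_costOfRatio hp)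
      (h.analyticAt_growthOfRatio hp) hmono fun x hx => h.abs_growthOfRatio_le hp hx

end IsModel

end

end BinomialMarket

open BinomialMarket in
theorem corollary6p2 (p d : ℝ) (hd0 : 0 < d) (hd1 : d < 1)
    (hp0 : d / (1 + d) < p) (hp1 : p < 1 / (1 + d)) :
    ∃ c R : ℝ → ℝ,
      (∀ lam ∈ Set.Ioo (0 : ℝ) 1,
        (c lam ∈ ratioInterval p d ∧ costOfRatio p d (c lam) = lam) ∧
        ∀ c' ∈ ratioInterval p d, costOfRatio p d c' = lam → c' = c lam) ∧
      (∀ lam ∈ Set.Ioo (0 : ℝ) 1, R lam = growthOfRatio p d (c lam)) ∧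
      (∀ lam ∈ Set.Ioo (0 : ℝ) 1, (∃ k : ℕ, 0 < k ∧ netSteps p d (c lam) = k) →
        ∀ x : ℝ, 0 < x → optimalGrowthRate p d lam x = (R lam : EReal)) ∧
      (∃ C : ℝ, ∀ lam ∈ Set.Ioo (0 : ℝ) 1,
        |R lam - (growthCoeffZero p d + growthCoeffOne p d * lam)| ≤ C * lam ^ 2) ∧
      growthCoeffOne p d < 0 := by
  have h := isModel_odds hd0 hd1 hp0 hp1
  -- Values of `c` outside `(0, 1)` are arbitrary; nothing is claimed about them.
  choose! c hc using fun lam (hl : lam ∈ Set.Ioo (0 : ℝ) 1) => h.exists_ratio hl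
  refine ⟨c, fun lam => growthOfRatio p d (c lam), fun lam hl => ⟨hc lam hl, fun c' hc' hF => ?_⟩,
    fun _ _ => rfl, fun lam hl hk x hx => ?_, ?_, h.growthCoeffOne_neg⟩
  · exact h.injOn_costOfRatio hc' (hc lam hl).1 (hF.trans (hc lam hl).2.symm)
  · obtain ⟨k, -, hk⟩ := hk
    exact h.optimalGrowthRate_eq_growthOfRatio hl.1 hl.2 (hc lam hl).1 (hc lam hl).2 hk hx
  · obtain ⟨C, hC⟩ := h.exists_expansion
    refine ⟨C, fun lam hl => ?_⟩
    have := hC (c lam) (hc lam hl).1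
    rw [(hc lam hl).2] at this
    exact this hl.2
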